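/- Let $\mathcal F^2$ be the Fock space of entire functions $f$ with $\int_{\mathbb C}|f(z)|^2e^{-|z|^2}\,dV(z)<\infty$, with inner product $\langle f,g\rangle=\frac1\pi\int_{\mathbb C}f(z)\overline{g(z)}e^{-|z|^2}\,dV(z)$. Let $a,b,c\in\mathbb C$ satisfy $|a|=1$, $\bar a b+\bar b=0$, $|c|^2e^{|b|^2}=1$, and let $\mathcal C_{a,b,c}$ be the conjugation on $\mathcal F^2$ given by $\mathcal C_{a,b,c}f(z)=ce^{bz}\overline{f(\overline{az+b})}$. Let $m\ge 0$ be an integer and let $\psi,\varphi,\phi$ be entire functions such that $\psi$ has no zeros and $\phi\not\equiv 0$; if $m\ge 1$, assume moreover that $\varphi$ is not constant. The maximal multi-valued weighted composition operator $S_{\max}$ is the multi-valued linear operator in $\mathcal F^2$ whose graph $G(S_{\max})$ consists of all pairs $(f,g)\in\mathcal F^2\times\mathcal F^2$ with $$\psi(z)f(\varphi(z))=\phi(z)g^{(m)}(z)\qquad(z\in\mathbb C).$$ Let $S$ be a multi-valued linear operator in $\mathcal F^2$ whose graph $G(S)$ (a linear subspace of $\mathcal F^2\times\mathcal F^2$)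 is contained in $G(S_{\max})$. Call $S$ $\mathcal C_{a,b,c}$-selfadjoint if $G(S)$ equals $$\{(u,v)\in\mathcal F^2\times\mathcal F^2:\ \langle g,\mathcal C_{a,b,c}u\rangle=\langle f,\mathcal C_{a,b,c}v\rangle\ \text{ for all }(f,g)\in G(S)\}.$$ Then $S$ is $\mathcal C_{a,b,c}$-selfadjoint if and only if both of the following conditions hold. 1. $S=S_{\max}$. 2. There are complex constants $A,B,C,D$ with $C\neq 0$ and $D=b+aB-bA$ such that $$\varphi(y)=Ay+B,\qquad Ce^{Dy}\phi(y)=\psi(y)\,[a(Ay+B)+b]^m\qquad\text{for all }y\in\mathbb C.$$ -/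

import Mathlib

open MeasureTheory

noncomputable section

/-- The Fock (Segal-Bargmann) space: the entire functions that are square integrable for the
Gaussian weight `exp (-|z|^2)` on the complex plane. -/
def FockSpace : Submodule ℂ (ℂ → ℂ) where
  carrier := {f | Differentiable ℂ f ∧
    Integrable (fun z : ℂ => ‖f z‖ ^ 2 * Real.exp (-‖z‖ ^ 2)) volume}
  zero_mem' := by
    refine ⟨differentiable_const (0 : ℂ), ?_⟩
    simp
  add_mem' := by
    rintro f g ⟨hf, hf2⟩ ⟨hg, hg2⟩
    refine ⟨hf.add hg, ?_⟩
    refine Integrable.mono' ((hf2.add hg2).const_mul 2) ?_ (Filter.Eventually.of_forall ?_)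
    · have h1 := hf.continuous
      have h2 := hg.continuous
      exact (((h1.add h2).norm.pow 2).mul
        (Real.continuous_exp.comp (continuous_norm.pow 2).neg)).aestronglyMeasurable
    · intro z
      have hE := Real.exp_pos (-‖z‖ ^ 2)
      have h1 : ‖f z + g z‖ ^ 2 ≤ 2 * (‖f z‖ ^ 2 + ‖g z‖ ^ 2) := by
        have h2 := norm_add_le (f z) (g z)
        have h3 := norm_nonneg (f z + g z)
        nlinarith [sq_nonneg (‖f z‖ - ‖g z‖)]
      rw [Real.norm_of_nonneg (by positivity)]
      simp only [Pi.add_apply]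
      nlinarith [mul_le_mul_of_nonneg_right h1 hE.le]
  smul_mem' := by
    rintro k f ⟨hf, hf2⟩
    refine ⟨hf.const_smul k, ?_⟩
    have h := hf2.const_mul (‖k‖ ^ 2)
    refine h.congr (Filter.Eventually.of_forall fun z => ?_)
    simp only [Pi.smul_apply, smul_eq_mul, norm_mul]
    ring

/-- The inner product of the Fock space, linear in the first variable. -/
def fockInner (f g : FockSpace) : ℂ :=
  (1 / (Real.pi : ℂ)) *
    ∫ z : ℂ, f.1 z * (starRingEnd ℂ) (g.1 z) * (Real.exp (-‖z‖ ^ 2) : ℂ)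

/-- The conditions on the parameters of a weighted composition conjugation. -/
structure IsConjugationParam (a b c : ℂ) : Prop where
  norm_a : ‖a‖ = 1
  rel : (starRingEnd ℂ) a * b + (starRingEnd ℂ) b = 0
  norm_c : ‖c‖ ^ 2 * Real.exp (‖b‖ ^ 2) = 1

/-- The function `z ↦ c * exp (b z) * conj (f (conj (a z + b)))`. -/
def wcConjFun (a b c : ℂ) (f : ℂ → ℂ) (z : ℂ) : ℂ :=
  c * Complex.exp (b * z) * (starRingEnd ℂ) (f ((starRingEnd ℂ) (a * z + b)))

theorem wcConjFun_weight {a b c : ℂ} (h : IsConjugationParam a b c) (f : ℂ → ℂ) (z : ℂ) :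
    ‖wcConjFun a b c f z‖ ^ 2 * Real.exp (-‖z‖ ^ 2) =
      ‖f ((starRingEnd ℂ) (a * z + b))‖ ^ 2 *
        Real.exp (-‖(starRingEnd ℂ) (a * z + b)‖ ^ 2) := by
  obtain ⟨ha, hr, hc⟩ := h
  have hb : a * (starRingEnd ℂ) b = -b := by
    have h1 : a * (starRingEnd ℂ) a = 1 := by
      rw [Complex.mul_conj, Complex.normSq_eq_norm_sq, ha]; simp
    linear_combination a * hr - b * h1
  have hn : ‖a * z + b‖ ^ 2 = ‖z‖ ^ 2 - 2 * (b * z).re + ‖b‖ ^ 2 := by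
    have h2 : (a * z * (starRingEnd ℂ) b).re = -(b * z).re := by
      have : a * z * (starRingEnd ℂ) b = -(b * z) := by linear_combination z * hb
      rw [this, Complex.neg_re]
    rw [← Complex.normSq_eq_norm_sq, Complex.normSq_add, h2, Complex.normSq_eq_norm_sq,
      Complex.normSq_eq_norm_sq, norm_mul, ha]
    ring
  have he : Real.exp (b * z).re ^ 2 * Real.exp (-‖z‖ ^ 2) =
      Real.exp (‖b‖ ^ 2) * Real.exp (-‖a * z + b‖ ^ 2) := by
    rw [hn, ← Real.exp_nat_mul, ← Real.exp_add, ← Real.exp_add]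
    congr 1
    push_cast
    ring
  simp only [wcConjFun, norm_mul, RCLike.norm_conj, Complex.norm_exp]
  linear_combination (‖c‖ ^ 2 * ‖f ((starRingEnd ℂ) (a * z + b))‖ ^ 2) * he +
    (‖f ((starRingEnd ℂ) (a * z + b))‖ ^ 2 * Real.exp (-‖a * z + b‖ ^ 2)) * hc

theorem wcConjFun_mem {a b c : ℂ} (h : IsConjugationParam a b c) {f : ℂ → ℂ}
    (hf : f ∈ FockSpace) : wcConjFun a b c f ∈ FockSpace := by
  obtain ⟨hd, hi⟩ := hf
  refine ⟨?_, ?_⟩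
  · have h1 : Differentiable ℂ (fun w : ℂ => (starRingEnd ℂ) (f ((starRingEnd ℂ) w))) :=
      fun w => differentiableAt_conj_conj_iff.2 (hd ((starRingEnd ℂ) w))
    have h2 : Differentiable ℂ (fun z : ℂ => a * z + b) := by fun_prop
    have h3 : Differentiable ℂ (fun z : ℂ => c * Complex.exp (b * z)) := by fun_prop
    exact h3.mul (h1.comp h2)
  · have ha : a ∈ Submonoid.unitSphere ℂ := by
      simp [Submonoid.unitSphere, h.norm_a]
    have hmp : MeasurePreserving (fun z : ℂ => (starRingEnd ℂ) (a * z + b)) volume volume := by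
      have e1 := (rotation (⟨a, ha⟩ : Circle)).measurePreserving
      have e2 := measurePreserving_add_right (volume : Measure ℂ) b
      have e3 := Complex.conjLIE.measurePreserving
      exact (e3.comp e2).comp e1
    have h4 := hmp.integrable_comp_of_integrable hi
    refine h4.congr (Filter.Eventually.of_forall fun z => ?_)
    exact (wcConjFun_weight h f z).symm

/-- The weighted composition conjugation on the Fock space. -/
def wcConj {a b c : ℂ} (h : IsConjugationParam a b c) (f : FockSpace) : FockSpace :=
  ⟨wcConjFun a b c f.1, wcConjFun_mem h f.2⟩

/-- A multi-valued linear operator in the Fock space, given by its graph. -/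
abbrev MultiOp := Submodule ℂ (FockSpace × FockSpace)

/-- The graph of the adjoint of the multi-valued operator `T` relative to a map `J`. -/
def adjointGraph (J : FockSpace → FockSpace) (T : MultiOp) : Set (FockSpace × FockSpace) :=
  {p | ∀ q ∈ T, fockInner q.2 (J p.1) = fockInner q.1 (J p.2)}

/-- `T` is selfadjoint relative to the conjugation `J`. -/
def IsJSelfadjoint (J : FockSpace → FockSpace) (T : MultiOp) : Prop :=
  adjointGraph J T = (T : Set (FockSpace × FockSpace))

/-- The maximal multi-valued weighted composition operator: the pairs `(f, g)` in the Fock space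
with `psi * (f ∘ varphi) = phi * g^(m)`. -/
def maxWCO (m : ℕ) (psi varphi phi : ℂ → ℂ) : MultiOp where
  carrier := {p | ∀ z, psi z * p.1.1 (varphi z) = phi z * iteratedDeriv m p.2.1 z}
  zero_mem' := by
    intro z
    have h0 : iteratedDeriv m (fun _ : ℂ => (0 : ℂ)) z = 0 := by
      simp
    have h1 : ((0 : FockSpace × FockSpace).2 : ℂ → ℂ) = fun _ => 0 := rfl
    rw [h1, h0]
    simp
  add_mem' := by
    intro p q hp hq z
    have h1 : ContDiffAt ℂ m p.2.1 z := p.2.2.1.contDiff.contDiffAt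
    have h2 : ContDiffAt ℂ m q.2.1 z := q.2.2.1.contDiff.contDiffAt
    have h3 : ((p + q).2 : ℂ → ℂ) = p.2.1 + q.2.1 := rfl
    have h4 : ((p + q).1 : ℂ → ℂ) = p.1.1 + q.1.1 := rfl
    rw [h3, h4, iteratedDeriv_add h1 h2, Pi.add_apply]
    linear_combination hp z + hq z
  smul_mem' := by
    intro k p hp z
    have h1 : ContDiffAt ℂ m p.2.1 z := p.2.2.1.contDiff.contDiffAt
    have h3 : ((k • p).2 : ℂ → ℂ) = k • p.2.1 := rfl
    have h4 : ((k • p).1 : ℂ → ℂ) = k • p.1.1 := rfl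
    rw [h3, h4, iteratedDeriv_const_smul h1 k, Pi.smul_apply, smul_eq_mul, smul_eq_mul]
    linear_combination k * hp z

end

/-! Write J for the conjugation. The form [f, g] = ⟨f, J g⟩ is bilinear and symmetric, and the
adjoint of S is its annihilator with respect to [g, u] − [f, v]. Evaluating the defining equation of
the maximal operator at y amounts to testing against one explicit pair of functions, `kernelPair` at
y. Hence the maximal graph is exactly the annihilator of all kernel pairs
(`mem_maxWCO_iff_kernelPair`).

If S is selfadjoint, the kernel pairs annihilate S, so they lie in S and therefore in the maximal
graph. This is a functional equation symmetric in y and z (`kernelPair_mem_maxWCO_iff`), and its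
solutions are the affine symbols of condition 2 (`exists_affine_of_kernel_equation`). Conversely,
condition 2 puts the kernel pairs in the maximal graph, so the adjoint of the maximal operator is
contained in it.

Both directions then need the symmetry [g, u] = [f, v] on the whole maximal graph
(`fockInner_wcConj_eq_of_mem_maxWCO`). For A ≠ 0, write f = (az+b)^m f₁ and u = (az+b)^m u₁, so that
g^(m) and v^(m) are the images of f₁ and u₁ under T k = C e^{Dz} k(Az+B). Since J turns (az+b)^m
into w^m, which is dual to m-fold differentiation, the claim is formally [T f₁, u₁] = [T u₁, f₁].
These integrals need not converge, and |A| may exceed 1. Each side is therefore regularized by a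
complex contraction parameter r, holomorphically in |r| < 1. For small real r Fubini gives equality,
the identity theorem spreads it over the disc, and r → 1⁻ gives the result
(`gaussPair_wcConjFun_eq_of_factor`). -/

/-- The integral of `f * conj g` against the Gaussian weight. -/
noncomputable def gaussPair (f g : ℂ → ℂ) : ℂ :=
  ∫ z : ℂ, f z * (starRingEnd ℂ) (g z) * (Real.exp (-‖z‖ ^ 2) : ℂ)

/-! ### Gaussian integrals, the mean value property and the pointwise growth bound. -/

theorem integrable_exp_neg_mul_sq_norm {ε : ℝ} (hε : 0 < ε) :
    Integrable (fun z : ℂ => Real.exp (-ε * ‖z‖ ^ 2)) := by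
  have h := GaussianFourier.integrable_cexp_neg_mul_sq_norm_add (V := ℂ) (b := (ε : ℂ))
    (by simpa using hε) 0 0
  refine h.norm.congr (Filter.Eventually.of_forall fun z => ?_)
  simp [Complex.norm_exp, ← Complex.ofReal_pow]

theorem exists_pow_mul_exp_le (n : ℕ) (C : ℝ) {ε : ℝ} (hε : 0 < ε) :
    ∃ M : ℝ, 0 ≤ M ∧ ∀ x : ℝ, 0 ≤ x → x ^ n * Real.exp (C * x) ≤ M * Real.exp (ε * x ^ 2) := by
  -- The factorial comes from x^n ≤ n! e^x, and (1 + C)²/(4ε) is the maximum of (1 + C)x − εx².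
  refine ⟨n.factorial * Real.exp ((1 + C) ^ 2 / (4 * ε)), by positivity, fun x hx => ?_⟩
  have h1 : x ^ n ≤ n.factorial * Real.exp x := by
    have := Real.pow_div_factorial_le_exp x hx n
    rwa [div_le_iff₀ (by positivity), mul_comm] at this
  have h2 : x + C * x ≤ (1 + C) ^ 2 / (4 * ε) + ε * x ^ 2 := by
    have h3 : (1 + C) ^ 2 / (4 * ε) + ε * x ^ 2 - (x + C * x) =
        ((1 + C) - 2 * ε * x) ^ 2 / (4 * ε) := by
      field_simp
      ring
    have h4 : 0 ≤ ((1 + C) - 2 * ε * x) ^ 2 / (4 * ε) := by positivity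
    linarith
  calc x ^ n * Real.exp (C * x) ≤ n.factorial * Real.exp x * Real.exp (C * x) := by gcongr
    _ = n.factorial * Real.exp (x + C * x) := by rw [Real.exp_add]; ring
    _ ≤ n.factorial * Real.exp ((1 + C) ^ 2 / (4 * ε) + ε * x ^ 2) := by gcongr
    _ = _ := by rw [Real.exp_add]; ring

theorem integral_exp_neg_sq_norm : ∫ z : ℂ, Real.exp (-‖z‖ ^ 2) = Real.pi := by
  have h := GaussianFourier.integral_rexp_neg_mul_sq_norm (V := ℂ) one_pos
  simpa [Complex.finrank_real_complex] using h

theorem measurePreserving_unit_mul {u : ℂ} (hu : ‖u‖ = 1) :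
    MeasurePreserving (fun z : ℂ => u * z) volume volume :=
  (rotation (⟨u, by simp [Submonoid.unitSphere, hu]⟩ : Circle)).measurePreserving

/-- The mean value property of entire functions for the Gaussian measure. -/
theorem integral_entire_mul_exp_neg_sq_norm {H : ℂ → ℂ} (hH : Differentiable ℂ H)
    (hi : Integrable (fun z : ℂ => H z * (Real.exp (-‖z‖ ^ 2) : ℂ))) :
    ∫ z : ℂ, H z * (Real.exp (-‖z‖ ^ 2) : ℂ) = Real.pi * H 0 := by
  -- The Gaussian measure is rotation invariant, so the integral may be averaged over all rotations.
  -- After Fubini the inner average is the mean of H on a circle about 0.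
  set u : ℝ → ℂ := circleMap 0 1 with hu
  have hu1 : ∀ θ, ‖u θ‖ = 1 := fun θ => by simp [hu]
  have hemb : ∀ θ, MeasurableEmbedding (fun z : ℂ => u θ * z) := fun θ =>
    (Homeomorph.mulLeft₀ (u θ) (by rw [← norm_ne_zero_iff, hu1]; simp)).measurableEmbedding
  have hrot : ∀ θ, ∫ z : ℂ, H (u θ * z) * (Real.exp (-‖z‖ ^ 2) : ℂ) =
      ∫ z : ℂ, H z * (Real.exp (-‖z‖ ^ 2) : ℂ) := by
    intro θ
    have := (measurePreserving_unit_mul (hu1 θ)).integral_comp (hemb θ)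
      (fun z => H z * (Real.exp (-‖z‖ ^ 2) : ℂ))
    simpa only [norm_mul, hu1, one_mul] using this
  have hroti : ∀ θ, Integrable (fun z : ℂ => H (u θ * z) * (Real.exp (-‖z‖ ^ 2) : ℂ)) := by
    intro θ
    have := (measurePreserving_unit_mul (hu1 θ)).integrable_comp_of_integrable hi
    simpa [hu1, Function.comp_def] using this
  have hrotn : ∀ θ, ∫ z : ℂ, ‖H (u θ * z) * (Real.exp (-‖z‖ ^ 2) : ℂ)‖ =
      ∫ z : ℂ, ‖H z * (Real.exp (-‖z‖ ^ 2) : ℂ)‖ := by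
    intro θ
    have := (measurePreserving_unit_mul (hu1 θ)).integral_comp (hemb θ)
      (fun z => ‖H z * (Real.exp (-‖z‖ ^ 2) : ℂ)‖)
    simpa only [norm_mul, hu1, one_mul] using this
  have hmean : ∀ z : ℂ, ∫ θ in (0 : ℝ)..2 * Real.pi, H (u θ * z) = 2 * Real.pi * H 0 := by
    intro z
    have h1 : DiffContOnCl ℂ (fun ζ : ℂ => H (ζ * z)) (Metric.ball 0 |1|) :=
      (hH.comp (differentiable_id.mul_const z)).diffContOnCl
    have h2 := h1.circleAverage
    rw [Real.circleAverage_def, zero_mul] at h2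
    have hpi : (Real.pi : ℂ) ≠ 0 := by exact_mod_cast Real.pi_ne_zero
    rw [← h2, Complex.real_smul]
    push_cast
    field_simp
    simp only [hu, mul_comm z]
  have hcont : Continuous u := continuous_circleMap 0 1
  have hprod : Integrable (Function.uncurry fun (θ : ℝ) (z : ℂ) =>
      H (u θ * z) * (Real.exp (-‖z‖ ^ 2) : ℂ))
      ((volume.restrict (Set.Ioc 0 (2 * Real.pi))).prod volume) := by
    have hc := hH.continuous
    refine (integrable_prod_iff ?_).2 ⟨Filter.Eventually.of_forall hroti, ?_⟩
    · refine Continuous.aestronglyMeasurable ?_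
      unfold Function.uncurry
      fun_prop
    · simp only [Function.uncurry_apply_pair, hrotn]
      exact integrable_const _
  have hswap := integral_integral_swap hprod
  simp only [hrot] at hswap
  have h3 : ∀ z : ℂ, ∫ θ in Set.Ioc 0 (2 * Real.pi), H (u θ * z) * (Real.exp (-‖z‖ ^ 2) : ℂ) =
      2 * Real.pi * H 0 * (Real.exp (-‖z‖ ^ 2) : ℂ) := by
    intro z
    rw [integral_mul_const, ← intervalIntegral.integral_of_le (by positivity), hmean]
  simp only [h3] at hswap
  rw [integral_const_mul, integral_complex_ofReal, integral_exp_neg_sq_norm] at hswap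
  have hpi : (Real.pi : ℂ) ≠ 0 := by exact_mod_cast Real.pi_ne_zero
  have hvol : (volume.restrict (Set.Ioc 0 (2 * Real.pi))).real Set.univ = 2 * Real.pi := by
    simp [measureReal_restrict_apply, Real.pi_pos.le]
  rw [integral_const, hvol, Complex.real_smul] at hswap
  refine mul_left_cancel₀ (mul_ne_zero two_ne_zero hpi) ?_
  push_cast at hswap ⊢
  rw [hswap]
  ring

theorem integrable_pow_mul_exp_mul_gauss (n : ℕ) (C : ℝ) {ε : ℝ} (hε : 0 < ε) :
    Integrable (fun z : ℂ => ‖z‖ ^ n * Real.exp (C * ‖z‖) * Real.exp (-ε * ‖z‖ ^ 2)) := by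
  obtain ⟨M, hM, h⟩ := exists_pow_mul_exp_le n C (half_pos hε)
  refine ((integrable_exp_neg_mul_sq_norm (half_pos hε)).const_mul M).mono'
    (Continuous.aestronglyMeasurable (by fun_prop)) (Filter.Eventually.of_forall fun z => ?_)
  rw [Real.norm_of_nonneg (by positivity)]
  calc _ ≤ M * Real.exp (ε / 2 * ‖z‖ ^ 2) * Real.exp (-ε * ‖z‖ ^ 2) := by
        exact mul_le_mul_of_nonneg_right (h _ (norm_nonneg z)) (Real.exp_pos _).le
    _ = _ := by
        rw [mul_assoc, ← Real.exp_add]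
        ring_nf

theorem FockSpace.exists_norm_le {f : ℂ → ℂ} (hf : f ∈ FockSpace) :
    ∃ K : ℝ, 0 ≤ K ∧ ∀ z, ‖f z‖ ≤ K * Real.exp (‖z‖ ^ 2 / 2) := by
  obtain ⟨hd, hi⟩ := hf
  set I : ℝ := ∫ z : ℂ, ‖f z‖ ^ 2 * Real.exp (-‖z‖ ^ 2) with hI
  refine ⟨Real.sqrt (I / Real.pi), Real.sqrt_nonneg _, fun z => ?_⟩
  have hI0 : 0 ≤ I := integral_nonneg fun z => by positivity
  -- The exponential absorbs the cross term of |z + ζ|², so the mean value H(0) = f(z)² is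
  -- controlled by the Fock integral of f translated by z.
  set H : ℂ → ℂ := fun ζ => f (z + ζ) ^ 2 * Complex.exp (-2 * (starRingEnd ℂ) z * ζ) with hH
  have hHd : Differentiable ℂ H := by
    have : Differentiable ℂ fun ζ => f (z + ζ) := hd.comp (by fun_prop)
    fun_prop
  have hn : ∀ ζ, ‖H ζ * (Real.exp (-‖ζ‖ ^ 2) : ℂ)‖ =
      Real.exp (‖z‖ ^ 2) * (‖f (z + ζ)‖ ^ 2 * Real.exp (-‖z + ζ‖ ^ 2)) := by
    intro ζ
    have h1 : ‖z + ζ‖ ^ 2 = ‖z‖ ^ 2 + ‖ζ‖ ^ 2 + 2 * ((starRingEnd ℂ) z * ζ).re := by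
      rw [← Complex.normSq_eq_norm_sq, add_comm z, Complex.normSq_add, Complex.normSq_eq_norm_sq,
        Complex.normSq_eq_norm_sq, mul_comm ((starRingEnd ℂ) z)]
      ring
    have h2 : (-2 * (starRingEnd ℂ) z * ζ).re = -2 * ((starRingEnd ℂ) z * ζ).re := by
      rw [mul_assoc, show (-2 : ℂ) = ((-2 : ℝ) : ℂ) by norm_num, Complex.re_ofReal_mul]
    rw [hH, norm_mul, norm_mul, norm_pow, Complex.norm_exp, Complex.norm_real, h2, h1,
      Real.norm_of_nonneg (Real.exp_pos _).le, mul_assoc, ← Real.exp_add, mul_left_comm,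
      ← Real.exp_add]
    congr 2
    ring
  have hint : Integrable (fun ζ => ‖H ζ * (Real.exp (-‖ζ‖ ^ 2) : ℂ)‖) := by
    simp only [hn]
    exact (hi.comp_add_left z).const_mul _
  have hint' : Integrable (fun ζ => H ζ * (Real.exp (-‖ζ‖ ^ 2) : ℂ)) := by
    refine (integrable_norm_iff (Continuous.aestronglyMeasurable ?_)).1 hint
    have := hHd.continuous
    fun_prop
  have hle := norm_integral_le_integral_norm (μ := volume) (fun ζ => H ζ * (Real.exp (-‖ζ‖ ^ 2) : ℂ))
  rw [integral_entire_mul_exp_neg_sq_norm hHd hint'] at hle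
  simp only [hn] at hle
  rw [integral_const_mul, integral_add_left_eq_self
    (fun w : ℂ => ‖f w‖ ^ 2 * Real.exp (-‖w‖ ^ 2)) z, ← hI] at hle
  have hle2 : Real.pi * ‖f z‖ ^ 2 ≤ Real.exp (‖z‖ ^ 2) * I := by
    simpa [hH, abs_of_pos Real.pi_pos] using hle
  have h3 : Real.exp (‖z‖ ^ 2) = Real.exp (‖z‖ ^ 2 / 2) ^ 2 := by
    rw [← Real.exp_nat_mul]
    ring_nf
  refine abs_le_of_sq_le_sq' ?_ (by positivity) |>.2
  rw [mul_pow, Real.sq_sqrt (by positivity), ← h3, div_mul_eq_mul_div,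
    le_div_iff₀ Real.pi_pos]
  linarith

/-! ### The reproducing kernel and its derivatives. -/

theorem norm_cexp_mul_conj_le (z w : ℂ) :
    ‖Complex.exp (z * (starRingEnd ℂ) w)‖ ≤ Real.exp (‖z‖ * ‖w‖) := by
  rw [Complex.norm_exp]
  gcongr
  exact (Complex.re_le_norm _).trans (by simp)

theorem norm_cexp_le (z : ℂ) : ‖Complex.exp z‖ ≤ Real.exp ‖z‖ := by
  rw [Complex.norm_exp]
  gcongr
  exact Complex.re_le_norm _

theorem norm_kernel_integrand_le {f : ℂ → ℂ} {K : ℝ}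
    (hK : ∀ z, ‖f z‖ ≤ K * Real.exp (‖z‖ ^ 2 / 2)) (n : ℕ) (z w : ℂ) :
    ‖f w * (starRingEnd ℂ) w ^ n * Complex.exp (z * (starRingEnd ℂ) w) *
      (Real.exp (-‖w‖ ^ 2) : ℂ)‖ ≤
      K * (‖w‖ ^ n * Real.exp (‖z‖ * ‖w‖) * Real.exp (-(1 / 2) * ‖w‖ ^ 2)) := by
  have h1 := norm_cexp_mul_conj_le z w
  rw [norm_mul, norm_mul, norm_mul, norm_pow, RCLike.norm_conj, Complex.norm_real,
    Real.norm_of_nonneg (Real.exp_pos _).le]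
  calc _ ≤ K * Real.exp (‖w‖ ^ 2 / 2) * ‖w‖ ^ n * Real.exp (‖z‖ * ‖w‖) *
        Real.exp (-‖w‖ ^ 2) := by
        gcongr
        · have := (norm_nonneg _).trans (hK w)
          positivity
        · exact hK w
    _ = K * (‖w‖ ^ n * Real.exp (‖z‖ * ‖w‖) *
        (Real.exp (‖w‖ ^ 2 / 2) * Real.exp (-‖w‖ ^ 2))) := by ring
    _ = _ := by
        rw [← Real.exp_add]
        ring_nf

theorem integrable_kernel_integrand {f : ℂ → ℂ} (hf : f ∈ FockSpace) (n : ℕ) (z : ℂ) :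
    Integrable fun w => f w * (starRingEnd ℂ) w ^ n * Complex.exp (z * (starRingEnd ℂ) w) *
      (Real.exp (-‖w‖ ^ 2) : ℂ) := by
  obtain ⟨K, -, hK⟩ := FockSpace.exists_norm_le hf
  have := hf.1.continuous
  have := Complex.continuous_conj
  exact ((integrable_pow_mul_exp_mul_gauss n ‖z‖ one_half_pos).const_mul K).mono'
    (Continuous.aestronglyMeasurable (by fun_prop))
    (Filter.Eventually.of_forall fun w => norm_kernel_integrand_le hK n z w)

theorem hasDerivAt_kernel_integral {f : ℂ → ℂ} (hf : f ∈ FockSpace) (n : ℕ) (z : ℂ) :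
    HasDerivAt (fun z => ∫ w, f w * (starRingEnd ℂ) w ^ n * Complex.exp (z * (starRingEnd ℂ) w) *
      (Real.exp (-‖w‖ ^ 2) : ℂ))
      (∫ w, f w * (starRingEnd ℂ) w ^ (n + 1) * Complex.exp (z * (starRingEnd ℂ) w) *
      (Real.exp (-‖w‖ ^ 2) : ℂ)) z := by
  obtain ⟨K, hK0, hK⟩ := FockSpace.exists_norm_le hf
  refine (hasDerivAt_integral_of_dominated_loc_of_deriv_le
    (Metric.ball_mem_nhds z one_pos)
    (Filter.Eventually.of_forall fun x => (integrable_kernel_integrand hf n x).aestronglyMeasurable)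
    (integrable_kernel_integrand hf n z)
    (F' := fun x w => f w * (starRingEnd ℂ) w ^ (n + 1) *
      Complex.exp (x * (starRingEnd ℂ) w) * (Real.exp (-‖w‖ ^ 2) : ℂ))
    (integrable_kernel_integrand hf (n + 1) z).aestronglyMeasurable
    (Filter.Eventually.of_forall fun w x hx =>
      (norm_kernel_integrand_le hK (n + 1) x w).trans (?_ : _ ≤ K * (‖w‖ ^ (n + 1) *
        Real.exp ((‖z‖ + 1) * ‖w‖) * Real.exp (-(1 / 2) * ‖w‖ ^ 2))))
    ((integrable_pow_mul_exp_mul_gauss (n + 1) (‖z‖ + 1) one_half_pos).const_mul K)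
    (Filter.Eventually.of_forall fun w x _ => ?_)).2
  · have hx1 : ‖x‖ ≤ ‖z‖ + 1 := by
      have h1 : ‖x - z‖ < 1 := by simpa [dist_eq_norm] using hx
      have h2 := norm_add_le (x - z) z
      rw [sub_add_cancel] at h2
      linarith
    gcongr
  · have h1 : HasDerivAt (fun x : ℂ => x * (starRingEnd ℂ) w) ((starRingEnd ℂ) w) x := by
      simpa using (hasDerivAt_id x).mul_const ((starRingEnd ℂ) w)
    have h2 := ((h1.cexp.const_mul (f w * (starRingEnd ℂ) w ^ n)).mul_const
      (Real.exp (-‖w‖ ^ 2) : ℂ))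
    exact h2.congr_deriv (by ring)

/-- The reproducing formula of the Fock space for derivatives. -/
theorem integral_kernel_eq_iteratedDeriv {f : ℂ → ℂ} (hf : f ∈ FockSpace) (n : ℕ) (z : ℂ) :
    ∫ w, f w * (starRingEnd ℂ) w ^ n * Complex.exp (z * (starRingEnd ℂ) w) *
      (Real.exp (-‖w‖ ^ 2) : ℂ) = Real.pi * iteratedDeriv n f z := by
  induction n generalizing z with
  | zero =>
    -- Translating by z turns the kernel integrand into an entire function times the centred
    -- Gaussian.
    set H : ℂ → ℂ := fun ζ => f (z + ζ) * Complex.exp (-(starRingEnd ℂ) z * ζ) with hH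
    have hHd : Differentiable ℂ H := by
      have : Differentiable ℂ fun ζ => f (z + ζ) := hf.1.comp (by fun_prop)
      exact this.mul (by fun_prop)
    have hshift : ∀ ζ, H ζ * (Real.exp (-‖ζ‖ ^ 2) : ℂ) =
        (fun w => f w * (starRingEnd ℂ) w ^ 0 * Complex.exp (z * (starRingEnd ℂ) w) *
          (Real.exp (-‖w‖ ^ 2) : ℂ)) (z + ζ) := by
      intro ζ
      have hsq : ∀ x : ℂ, ((‖x‖ : ℂ)) ^ 2 = x * (starRingEnd ℂ) x := fun x =>
        (Complex.mul_conj' x).symm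
      simp only [hH, pow_zero, mul_one, mul_assoc, Complex.ofReal_exp, Complex.ofReal_neg,
        Complex.ofReal_pow, ← Complex.exp_add, hsq]
      congr 2
      rw [map_add]
      ring
    have hi := (integrable_kernel_integrand hf 0 z).comp_add_left z
    have h1 := integral_entire_mul_exp_neg_sq_norm hHd (by simpa only [hshift] using hi)
    simp only [hshift] at h1
    rw [integral_add_left_eq_self (fun w => f w * (starRingEnd ℂ) w ^ 0 *
      Complex.exp (z * (starRingEnd ℂ) w) * (Real.exp (-‖w‖ ^ 2) : ℂ)) z] at h1
    rw [h1]
    simp [hH]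
  | succ n ih =>
    have h1 := hasDerivAt_kernel_integral hf n z
    simp only [ih] at h1
    have hd : HasDerivAt (iteratedDeriv n f) (iteratedDeriv (n + 1) f z) z := by
      rw [iteratedDeriv_succ]
      have h2 : ContDiff ℂ (n + 1 : ℕ) f := hf.1.contDiff
      exact (h2.differentiable_iteratedDeriv n (by exact_mod_cast n.lt_succ_self)
        z).hasDerivAt
    exact h1.unique (hd.const_mul _)

/-! ### Adjoints of contractive weighted composition operators. -/

/-- Domination for Fubini. The growth bounds use up half of each Gaussian, and |q||z||w| ≤ |q|(|z|²
+ |w|²)/2 leaves the exponent (1 − |q|)/2 in each variable; this is where |q| < 1 will be needed. -/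
theorem norm_double_kernel_le {f k : ℂ → ℂ} {K L : ℝ} (hL0 : 0 ≤ L)
    (hK : ∀ z, ‖f z‖ ≤ K * Real.exp (‖z‖ ^ 2 / 2))
    (hL : ∀ z, ‖k z‖ ≤ L * Real.exp (‖z‖ ^ 2 / 2)) (n : ℕ) (q s t z w : ℂ) :
    ‖Complex.exp (s * z) * (starRingEnd ℂ) (k z) * (Real.exp (-‖z‖ ^ 2) : ℂ) *
      (f w * (starRingEnd ℂ) w ^ n * Complex.exp ((q * z + t) * (starRingEnd ℂ) w) *
      (Real.exp (-‖w‖ ^ 2) : ℂ))‖ ≤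
    (L * (‖z‖ ^ 0 * Real.exp (‖s‖ * ‖z‖) * Real.exp (-((1 - ‖q‖) / 2) * ‖z‖ ^ 2))) *
      (K * (‖w‖ ^ n * Real.exp (‖t‖ * ‖w‖) * Real.exp (-((1 - ‖q‖) / 2) * ‖w‖ ^ 2))) := by
  have hK0 : 0 ≤ K := by
    have := (norm_nonneg _).trans (hK 0)
    simpa using this
  have h1 := norm_kernel_integrand_le hK n (q * z + t) w
  have h2 : ‖Complex.exp (s * z)‖ ≤ Real.exp (‖s‖ * ‖z‖) := by
    simpa using norm_cexp_le (s * z)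
  have h3 : ‖q * z + t‖ * ‖w‖ ≤ ‖q‖ / 2 * ‖z‖ ^ 2 + ‖q‖ / 2 * ‖w‖ ^ 2 + ‖t‖ * ‖w‖ := by
    have h4 : ‖q * z + t‖ ≤ ‖q‖ * ‖z‖ + ‖t‖ := by simpa using norm_add_le (q * z) t
    have h5 := mul_le_mul_of_nonneg_right h4 (norm_nonneg w)
    have h6 := mul_nonneg (norm_nonneg q) (sq_nonneg (‖z‖ - ‖w‖))
    nlinarith
  rw [norm_mul]
  refine (mul_le_mul_of_nonneg_left h1 (norm_nonneg _)).trans ?_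
  rw [norm_mul, norm_mul, RCLike.norm_conj, Complex.norm_real,
    Real.norm_of_nonneg (Real.exp_pos _).le, pow_zero, one_mul]
  calc _ ≤ Real.exp (‖s‖ * ‖z‖) * (L * Real.exp (‖z‖ ^ 2 / 2)) * Real.exp (-‖z‖ ^ 2) *
        (K * (‖w‖ ^ n * Real.exp (‖q‖ / 2 * ‖z‖ ^ 2 + ‖q‖ / 2 * ‖w‖ ^ 2 + ‖t‖ * ‖w‖) *
          Real.exp (-(1 / 2) * ‖w‖ ^ 2))) := by
        gcongr
        exact hL z
    _ = L * (Real.exp (‖s‖ * ‖z‖) * (Real.exp (‖z‖ ^ 2 / 2) * Real.exp (-‖z‖ ^ 2) *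
          Real.exp (‖q‖ / 2 * ‖z‖ ^ 2))) *
        (K * (‖w‖ ^ n * Real.exp (‖t‖ * ‖w‖) *
          (Real.exp (‖q‖ / 2 * ‖w‖ ^ 2) * Real.exp (-(1 / 2) * ‖w‖ ^ 2)))) := by
        rw [Real.exp_add, Real.exp_add]
        ring
    _ = _ := by
        rw [← Real.exp_add, ← Real.exp_add, ← Real.exp_add (‖q‖ / 2 * ‖w‖ ^ 2)]
        ring_nf

/-- The adjoint of a contractive weighted composition-differentiation operator. -/
theorem gaussPair_weighted_comp_iteratedDeriv {f k : ℂ → ℂ} (hf : f ∈ FockSpace)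
    (hk : k ∈ FockSpace) (n : ℕ) {q : ℂ} (hq : ‖q‖ < 1) (s t : ℂ) :
    gaussPair (fun z => Complex.exp (s * z) * iteratedDeriv n f (q * z + t)) k =
      gaussPair f (fun w => w ^ n * Complex.exp ((starRingEnd ℂ) t * w) *
        k ((starRingEnd ℂ) q * w + (starRingEnd ℂ) s)) := by
  obtain ⟨K, hK0, hK⟩ := FockSpace.exists_norm_le hf
  obtain ⟨L, hL0, hL⟩ := FockSpace.exists_norm_le hk
  have hcf := hf.1.continuous
  have hck := hk.1.continuous
  have hcc := Complex.continuous_conj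
  have hε : 0 < (1 - ‖q‖) / 2 := by linarith
  have hpi : (Real.pi : ℂ) ≠ 0 := by exact_mod_cast Real.pi_ne_zero
  have hprod : Integrable (Function.uncurry fun z w : ℂ =>
      Complex.exp (s * z) * (starRingEnd ℂ) (k z) * (Real.exp (-‖z‖ ^ 2) : ℂ) *
      (f w * (starRingEnd ℂ) w ^ n * Complex.exp ((q * z + t) * (starRingEnd ℂ) w) *
      (Real.exp (-‖w‖ ^ 2) : ℂ))) (volume.prod volume) := by
    refine (((integrable_pow_mul_exp_mul_gauss 0 ‖s‖ hε).const_mul L).mul_prod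
      ((integrable_pow_mul_exp_mul_gauss n ‖t‖ hε).const_mul K)).mono'
      (Continuous.aestronglyMeasurable ?_) (Filter.Eventually.of_forall fun x =>
        norm_double_kernel_le hL0 hK hL n q s t x.1 x.2)
    unfold Function.uncurry
    fun_prop
  have hswap := integral_integral_swap hprod
  have hleft : ∀ z : ℂ, ∫ w, Complex.exp (s * z) * (starRingEnd ℂ) (k z) *
      (Real.exp (-‖z‖ ^ 2) : ℂ) *
      (f w * (starRingEnd ℂ) w ^ n * Complex.exp ((q * z + t) * (starRingEnd ℂ) w) *
      (Real.exp (-‖w‖ ^ 2) : ℂ)) = Real.pi * (Complex.exp (s * z) *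
        iteratedDeriv n f (q * z + t) * (starRingEnd ℂ) (k z) * (Real.exp (-‖z‖ ^ 2) : ℂ)) := by
    intro z
    rw [integral_const_mul, integral_kernel_eq_iteratedDeriv hf]
    ring
  have hright : ∀ w : ℂ, ∫ z, Complex.exp (s * z) * (starRingEnd ℂ) (k z) *
      (Real.exp (-‖z‖ ^ 2) : ℂ) *
      (f w * (starRingEnd ℂ) w ^ n * Complex.exp ((q * z + t) * (starRingEnd ℂ) w) *
      (Real.exp (-‖w‖ ^ 2) : ℂ)) = Real.pi * (f w * (starRingEnd ℂ) (w ^ n *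
        Complex.exp ((starRingEnd ℂ) t * w) *
        k ((starRingEnd ℂ) q * w + (starRingEnd ℂ) s)) * (Real.exp (-‖w‖ ^ 2) : ℂ)) := by
    intro w
    have h1 := integral_kernel_eq_iteratedDeriv hk 0
      ((starRingEnd ℂ) q * w + (starRingEnd ℂ) s)
    have h2 := congrArg (starRingEnd ℂ) h1
    rw [← integral_conj, iteratedDeriv_zero, map_mul, Complex.conj_ofReal] at h2
    have h3 : ∀ z : ℂ, Complex.exp (s * z) * (starRingEnd ℂ) (k z) *
        (Real.exp (-‖z‖ ^ 2) : ℂ) *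
        (f w * (starRingEnd ℂ) w ^ n * Complex.exp ((q * z + t) * (starRingEnd ℂ) w) *
        (Real.exp (-‖w‖ ^ 2) : ℂ)) =
        (f w * (starRingEnd ℂ) w ^ n * Complex.exp (t * (starRingEnd ℂ) w) *
        (Real.exp (-‖w‖ ^ 2) : ℂ)) * (starRingEnd ℂ) (k z * (starRingEnd ℂ) z ^ 0 *
        Complex.exp (((starRingEnd ℂ) q * w + (starRingEnd ℂ) s) * (starRingEnd ℂ) z) *
        (Real.exp (-‖z‖ ^ 2) : ℂ)) := by
      intro z
      simp only [map_mul, map_add, ← Complex.exp_conj, Complex.conj_conj, Complex.conj_ofReal,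
        pow_zero, mul_one]
      have h4 : Complex.exp (s * z) * Complex.exp ((q * z + t) * (starRingEnd ℂ) w) =
          Complex.exp (t * (starRingEnd ℂ) w) * Complex.exp ((q * (starRingEnd ℂ) w + s) * z) := by
        rw [← Complex.exp_add, ← Complex.exp_add]
        ring_nf
      linear_combination ((starRingEnd ℂ) (k z) * (Real.exp (-‖z‖ ^ 2) : ℂ) * f w *
        (starRingEnd ℂ) w ^ n * (Real.exp (-‖w‖ ^ 2) : ℂ)) * h4
    simp only [h3]
    rw [integral_const_mul, h2]
    simp only [map_mul, map_pow, ← Complex.exp_conj, Complex.conj_conj]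
    ring
  simp only [hleft, hright] at hswap
  rw [integral_const_mul, integral_const_mul] at hswap
  exact mul_left_cancel₀ hpi hswap

/-! ### Regularized pairings, holomorphic in the contraction parameter. -/

/-- A bound on the integrand alone suffices: Cauchy's estimate on circles of radius ε/2 dominates
the derivative in the parameter. -/
theorem differentiableAt_integral_of_norm_le {G : ℂ → ℂ → ℂ} {r₀ : ℂ} {ε : ℝ} (hε : 0 < ε)
    (hcont : Continuous (Function.uncurry G)) {bound : ℂ → ℝ} (hb : Integrable bound)
    (hle : ∀ r ∈ Metric.ball r₀ ε, ∀ w, ‖G r w‖ ≤ bound w)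
    (hd : ∀ w, Differentiable ℂ fun r => G r w) :
    DifferentiableAt ℂ (fun r => ∫ w, G r w) r₀ := by
  have hG : ∀ r, Continuous (G r) := fun r => by
    have : G r = fun w => Function.uncurry G (r, w) := rfl
    rw [this]
    fun_prop
  have hswap : Continuous (Function.uncurry fun w r => G r w) := hcont.comp continuous_swap
  have hmeas : Measurable fun w => deriv (fun r => G r w) r₀ :=
    (measurable_deriv_with_param hswap).comp (measurable_id.prodMk measurable_const)
  refine (hasDerivAt_integral_of_dominated_loc_of_deriv_le
    (Metric.ball_mem_nhds r₀ (half_pos hε))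
    (F' := fun r w => deriv (fun r => G r w) r)
    (bound := fun w => bound w / (ε / 2))
    (Filter.Eventually.of_forall fun r => (hG r).aestronglyMeasurable)
    (hb.mono' (hG r₀).aestronglyMeasurable (Filter.Eventually.of_forall fun w =>
      hle r₀ (Metric.mem_ball_self hε) w))
    hmeas.aestronglyMeasurable
    (Filter.Eventually.of_forall fun w r hr => ?_) (hb.div_const _)
    (Filter.Eventually.of_forall fun w r _ => (hd w r).hasDerivAt)).2.differentiableAt
  refine Complex.norm_deriv_le_of_forall_mem_sphere_norm_le (half_pos hε)
    (hd w).diffContOnCl fun z hz => hle z ?_ w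
  rw [Metric.mem_ball] at hr ⊢
  rw [Metric.mem_sphere] at hz
  linarith [dist_triangle z r r₀]

/-- The pairing of `h` with the regularization at parameter `r` of the function `w ^ m * F`. -/
noncomputable def regPair (m : ℕ) (α δ : ℂ) (F h : ℂ → ℂ) (r : ℂ) : ℂ :=
  gaussPair (fun w => w ^ m * Complex.exp ((1 - r) * α * w) * F (r * w + (1 - r) * δ)) h

theorem norm_regPair_integrand_le {F h : ℂ → ℂ} {K L : ℝ} (hK0 : 0 ≤ K) (hL0 : 0 ≤ L)
    (hK : ∀ z, ‖F z‖ ≤ K * Real.exp (‖z‖ ^ 2 / 2))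
    (hL : ∀ z, ‖h z‖ ≤ L * Real.exp (‖z‖ ^ 2 / 2)) (m : ℕ) (α δ : ℂ) {ρ : ℝ} (hρ : ρ ≤ 1)
    {r : ℂ} (hr : ‖r‖ ≤ ρ) (w : ℂ) :
    ‖w ^ m * Complex.exp ((1 - r) * α * w) * F (r * w + (1 - r) * δ) * (starRingEnd ℂ) (h w) *
      (Real.exp (-‖w‖ ^ 2) : ℂ)‖ ≤
    K * L * Real.exp (2 * ‖δ‖ ^ 2) * (‖w‖ ^ m * Real.exp ((2 * ‖α‖ + 2 * ‖δ‖) * ‖w‖) *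
      Real.exp (-((1 - ρ ^ 2) / 2) * ‖w‖ ^ 2)) := by
  have hρ0 : 0 ≤ ρ := (norm_nonneg r).trans hr
  have h1 : ‖1 - r‖ ≤ 2 := by
    have := norm_sub_le (1 : ℂ) r
    rw [norm_one] at this
    linarith
  have h2 : ‖Complex.exp ((1 - r) * α * w)‖ ≤ Real.exp (2 * ‖α‖ * ‖w‖) := by
    refine (norm_cexp_le _).trans ?_
    rw [norm_mul, norm_mul]
    gcongr
  have h3 : ‖r * w + (1 - r) * δ‖ ≤ ρ * ‖w‖ + 2 * ‖δ‖ := by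
    refine (norm_add_le _ _).trans ?_
    rw [norm_mul, norm_mul]
    gcongr
  have h4 : ‖r * w + (1 - r) * δ‖ ^ 2 / 2 ≤
      ρ ^ 2 / 2 * ‖w‖ ^ 2 + 2 * ‖δ‖ * ‖w‖ + 2 * ‖δ‖ ^ 2 := by
    have h5 := pow_le_pow_left₀ (norm_nonneg _) h3 2
    have h6 := mul_nonneg (mul_nonneg (sub_nonneg.2 hρ) (norm_nonneg δ)) (norm_nonneg w)
    nlinarith
  rw [norm_mul, norm_mul, norm_mul, norm_mul, norm_pow, RCLike.norm_conj, Complex.norm_real,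
    Real.norm_of_nonneg (Real.exp_pos _).le]
  calc _ ≤ ‖w‖ ^ m * Real.exp (2 * ‖α‖ * ‖w‖) * (K * Real.exp (‖r * w + (1 - r) * δ‖ ^ 2 / 2)) *
        (L * Real.exp (‖w‖ ^ 2 / 2)) * Real.exp (-‖w‖ ^ 2) := by
        gcongr
        · exact hK _
        · exact hL w
    _ ≤ ‖w‖ ^ m * Real.exp (2 * ‖α‖ * ‖w‖) *
        (K * Real.exp (ρ ^ 2 / 2 * ‖w‖ ^ 2 + 2 * ‖δ‖ * ‖w‖ + 2 * ‖δ‖ ^ 2)) *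
        (L * Real.exp (‖w‖ ^ 2 / 2)) * Real.exp (-‖w‖ ^ 2) := by
        gcongr
    _ = K * L * Real.exp (2 * ‖δ‖ ^ 2) * (‖w‖ ^ m *
        (Real.exp (2 * ‖α‖ * ‖w‖) * Real.exp (2 * ‖δ‖ * ‖w‖)) *
        (Real.exp (ρ ^ 2 / 2 * ‖w‖ ^ 2) * Real.exp (‖w‖ ^ 2 / 2) * Real.exp (-‖w‖ ^ 2))) := by
        rw [Real.exp_add, Real.exp_add]
        ring
    _ = _ := by
        rw [← Real.exp_add, ← Real.exp_add, ← Real.exp_add]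
        ring_nf

theorem integrable_regPair_integrand {F h : ℂ → ℂ} (hF : F ∈ FockSpace) (hh : h ∈ FockSpace)
    (m : ℕ) (α δ : ℂ) {r : ℂ} (hr : ‖r‖ < 1) :
    Integrable fun w => w ^ m * Complex.exp ((1 - r) * α * w) * F (r * w + (1 - r) * δ) *
      (starRingEnd ℂ) (h w) * (Real.exp (-‖w‖ ^ 2) : ℂ) := by
  obtain ⟨K, hK0, hK⟩ := FockSpace.exists_norm_le hF
  obtain ⟨L, hL0, hL⟩ := FockSpace.exists_norm_le hh
  have hcF := hF.1.continuous
  have hch := hh.1.continuous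
  have hcc := Complex.continuous_conj
  have hε : 0 < (1 - ‖r‖ ^ 2) / 2 := by nlinarith [norm_nonneg r]
  exact ((integrable_pow_mul_exp_mul_gauss m _ hε).const_mul _).mono'
    (Continuous.aestronglyMeasurable (by fun_prop)) (Filter.Eventually.of_forall fun w =>
      norm_regPair_integrand_le hK0 hL0 hK hL m α δ hr.le le_rfl w)

theorem differentiableOn_regPair {F h : ℂ → ℂ} (hF : F ∈ FockSpace) (hh : h ∈ FockSpace)
    (m : ℕ) (α δ : ℂ) : DifferentiableOn ℂ (regPair m α δ F h) (Metric.ball 0 1) := by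
  intro r₀ hr₀
  refine DifferentiableAt.differentiableWithinAt ?_
  obtain ⟨K, hK0, hK⟩ := FockSpace.exists_norm_le hF
  obtain ⟨L, hL0, hL⟩ := FockSpace.exists_norm_le hh
  have hcF := hF.1.continuous
  have hch := hh.1.continuous
  have hcc := Complex.continuous_conj
  have hr₀' : ‖r₀‖ < 1 := by simpa using hr₀
  set ρ : ℝ := (1 + ‖r₀‖) / 2 with hρ
  have hρ1 : ρ < 1 := by rw [hρ]; linarith
  have hρ0 : 0 ≤ ρ := by positivity
  have hε : 0 < (1 - ρ ^ 2) / 2 := by nlinarith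
  refine differentiableAt_integral_of_norm_le (ε := (1 - ‖r₀‖) / 2) (by linarith) ?_
    ((integrable_pow_mul_exp_mul_gauss m _ hε).const_mul _)
    (fun r hr w => norm_regPair_integrand_le hK0 hL0 hK hL m α δ hρ1.le ?_ w) fun w => ?_
  · unfold Function.uncurry
    fun_prop
  · have h1 : ‖r - r₀‖ < (1 - ‖r₀‖) / 2 := by simpa [dist_eq_norm] using hr
    have h2 := norm_add_le (r - r₀) r₀
    rw [sub_add_cancel] at h2
    rw [hρ]
    linarith
  · have h3 : Differentiable ℂ fun r : ℂ => F (r * w + (1 - r) * δ) := hF.1.comp (by fun_prop)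
    have h4 : Differentiable ℂ fun r : ℂ => w ^ m * Complex.exp ((1 - r) * α * w) := by fun_prop
    exact ((h4.mul h3).mul_const _).mul_const _

/-! ### The limit of the regularized pairings as r → 1⁻. -/

/-- Bounded nets in the Gaussian `L²` space that tend to zero pointwise tend to zero weakly. -/
theorem tendsto_gaussPair_zero {l : Filter ℝ} [l.IsCountablyGenerated] {D : ℝ → ℂ → ℂ}
    {h : ℂ → ℂ} (hh : Continuous h)
    (hhi : Integrable (fun w : ℂ => ‖h w‖ ^ 2 * Real.exp (-‖w‖ ^ 2)))
    (hD : ∀ᶠ r in l, Continuous (D r))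
    (hDi : ∀ᶠ r in l, Integrable (fun w : ℂ => ‖D r w‖ ^ 2 * Real.exp (-‖w‖ ^ 2)))
    {M : ℝ} (hM : ∀ᶠ r in l, ∫ w : ℂ, ‖D r w‖ ^ 2 * Real.exp (-‖w‖ ^ 2) ≤ M)
    (hlim : ∀ w, Filter.Tendsto (fun r => D r w) l (nhds 0)) :
    Filter.Tendsto (fun r => gaussPair (D r) h) l (nhds 0) := by
  rw [Metric.tendsto_nhds]
  intro ε hε
  -- By Young's inequality |D||h| ≤ η|D|² + min(|D||h|, |h|²/(4η)). The first term integrates to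
  -- less than ε/2, and the truncated one tends to 0 by dominated convergence.
  set η : ℝ := ε / (2 * (|M| + 1)) with hη
  have hη0 : 0 < η := by positivity
  have hηM : η * M < ε / 2 := by
    have h1 : η * M ≤ η * |M| := by gcongr; exact le_abs_self M
    have h2 : η * (|M| + 1) = ε / 2 := by rw [hη]; field_simp
    nlinarith
  have hmin : Filter.Tendsto (fun r => ∫ w : ℂ, min (‖D r w‖ * ‖h w‖) (‖h w‖ ^ 2 / (4 * η)) *
      Real.exp (-‖w‖ ^ 2)) l (nhds (∫ _ : ℂ, 0)) := by
    refine tendsto_integral_filter_of_dominated_convergence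
      (fun w => 1 / (4 * η) * (‖h w‖ ^ 2 * Real.exp (-‖w‖ ^ 2))) ?_ ?_ (hhi.const_mul _) ?_
    · filter_upwards [hD] with r hr
      exact Continuous.aestronglyMeasurable (by fun_prop)
    · refine Filter.Eventually.of_forall fun r => Filter.Eventually.of_forall fun w => ?_
      rw [Real.norm_of_nonneg (by positivity)]
      calc _ ≤ ‖h w‖ ^ 2 / (4 * η) * Real.exp (-‖w‖ ^ 2) := by
            gcongr
            exact min_le_right _ _
        _ = _ := by ring
    · refine Filter.Eventually.of_forall fun w => ?_
      have h1 : Filter.Tendsto (fun r => ‖D r w‖ * ‖h w‖) l (nhds 0) := by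
        simpa using (hlim w).norm.mul_const ‖h w‖
      have h2 := (h1.min (tendsto_const_nhds (x := ‖h w‖ ^ 2 / (4 * η)))).mul_const
        (Real.exp (-‖w‖ ^ 2))
      rwa [min_eq_left (by positivity), zero_mul] at h2
  rw [integral_zero] at hmin
  filter_upwards [hD, hDi, hM, hmin.eventually (gt_mem_nhds (half_pos hε))] with r h1 h2 h3 h4
  rw [dist_zero_right]
  have hmini : Integrable fun w : ℂ => min (‖D r w‖ * ‖h w‖) (‖h w‖ ^ 2 / (4 * η)) *
      Real.exp (-‖w‖ ^ 2) := by
    refine (hhi.const_mul (1 / (4 * η))).mono' (Continuous.aestronglyMeasurable (by fun_prop))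
      (Filter.Eventually.of_forall fun w => ?_)
    rw [Real.norm_of_nonneg (by positivity)]
    calc _ ≤ ‖h w‖ ^ 2 / (4 * η) * Real.exp (-‖w‖ ^ 2) := by
          gcongr
          exact min_le_right _ _
      _ = _ := by ring
  have hle : ‖gaussPair (D r) h‖ ≤ ∫ w : ℂ, (η * (‖D r w‖ ^ 2 * Real.exp (-‖w‖ ^ 2)) +
      min (‖D r w‖ * ‖h w‖) (‖h w‖ ^ 2 / (4 * η)) * Real.exp (-‖w‖ ^ 2)) := by
    refine norm_integral_le_of_norm_le ((h2.const_mul η).add hmini)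
      (Filter.Eventually.of_forall fun w => ?_)
    rw [norm_mul, norm_mul, RCLike.norm_conj, Complex.norm_real,
      Real.norm_of_nonneg (Real.exp_pos _).le, ← mul_assoc, ← add_mul]
    gcongr
    rw [← sub_le_iff_le_add']
    refine le_min (by nlinarith [sq_nonneg ‖D r w‖]) ?_
    rw [le_div_iff₀ (by positivity)]
    nlinarith [sq_nonneg (2 * η * ‖D r w‖ - ‖h w‖)]
  rw [integral_add (h2.const_mul η) hmini, integral_const_mul] at hle
  have : η * ∫ w : ℂ, ‖D r w‖ ^ 2 * Real.exp (-‖w‖ ^ 2) ≤ η * M := by gcongr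
  linarith

/-- Both the linear exponent and the gap |w|² − |rw + (1−r)δ|² carry a factor 1 − r, so completing
the square gives a constant that does not depend on r. -/
theorem norm_sq_regularization_le (F : ℂ → ℂ) (α δ : ℂ) {r : ℝ} (hr0 : 0 ≤ r) (hr1 : r ≤ 1)
    (w : ℂ) :
    ‖Complex.exp ((1 - r) * α * w) * F (r * w + (1 - r) * δ)‖ ^ 2 * Real.exp (-‖w‖ ^ 2) ≤
      Real.exp ((‖α‖ + ‖δ‖) ^ 2 + ‖δ‖ ^ 2) *
        (‖F (r * w + (1 - r) * δ)‖ ^ 2 * Real.exp (-‖r * w + (1 - r) * δ‖ ^ 2)) := by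
  have hn : ‖(1 - r : ℂ)‖ = 1 - r := by
    rw [← Complex.ofReal_one, ← Complex.ofReal_sub, Complex.norm_real,
      Real.norm_of_nonneg (by linarith)]
  have h1 : ‖Complex.exp ((1 - r) * α * w)‖ ≤ Real.exp ((1 - r) * ‖α‖ * ‖w‖) := by
    simpa [hn] using norm_cexp_le ((1 - r) * α * w)
  have h2 : ‖r * w + (1 - r) * δ‖ ≤ r * ‖w‖ + (1 - r) * ‖δ‖ := by
    refine (norm_add_le _ _).trans ?_
    rw [norm_mul, norm_mul, hn, Complex.norm_real, Real.norm_of_nonneg hr0]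
  have h3 := pow_le_pow_left₀ (norm_nonneg _) h2 2
  have h4 : 2 * ((1 - r) * ‖α‖ * ‖w‖) + -‖w‖ ^ 2 ≤
      (‖α‖ + ‖δ‖) ^ 2 + ‖δ‖ ^ 2 + -‖r * w + (1 - r) * δ‖ ^ 2 := by
    set x := ‖w‖
    set p := ‖α‖
    set d := ‖δ‖
    have hx : 0 ≤ x := norm_nonneg _
    have hp : 0 ≤ p := norm_nonneg _
    have hd : 0 ≤ d := norm_nonneg _
    have e1 : 2 * p * x + 2 * r * x * d + (1 - r) * d ^ 2 - (1 + r) * x ^ 2 ≤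
        (p + d) ^ 2 + d ^ 2 := by
      have := mul_nonneg (mul_nonneg (sub_nonneg.2 hr1) hx) hd
      nlinarith [sq_nonneg (x - (p + d)), mul_nonneg hr0 (sq_nonneg x),
        mul_nonneg hr0 (sq_nonneg d)]
    have e2 := mul_le_mul_of_nonneg_left e1 (sub_nonneg.2 hr1)
    have e3 : 0 ≤ r * ((p + d) ^ 2 + d ^ 2) := by positivity
    nlinarith
  rw [norm_mul, mul_pow]
  calc _ ≤ Real.exp ((1 - r) * ‖α‖ * ‖w‖) ^ 2 * ‖F (r * w + (1 - r) * δ)‖ ^ 2 *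
        Real.exp (-‖w‖ ^ 2) := by gcongr
    _ = ‖F (r * w + (1 - r) * δ)‖ ^ 2 *
        Real.exp (2 * ((1 - r) * ‖α‖ * ‖w‖) + -‖w‖ ^ 2) := by
        rw [Real.exp_add, ← Real.exp_nat_mul]
        push_cast
        ring
    _ ≤ ‖F (r * w + (1 - r) * δ)‖ ^ 2 *
        Real.exp ((‖α‖ + ‖δ‖) ^ 2 + ‖δ‖ ^ 2 + -‖r * w + (1 - r) * δ‖ ^ 2) := by gcongr
    _ = _ := by
        rw [Real.exp_add]
        ring

theorem tendsto_regPair_zero_exponent {F h : ℂ → ℂ} (hF : F ∈ FockSpace) (hh : h ∈ FockSpace)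
    (α δ : ℂ) :
    Filter.Tendsto (fun r : ℝ => regPair 0 α δ F h r) (nhdsWithin 1 (Set.Iio 1))
      (nhds (gaussPair F h)) := by
  have hcF := hF.1.continuous
  have hch := hh.1.continuous
  set E := (‖α‖ + ‖δ‖) ^ 2 + ‖δ‖ ^ 2 with hE
  set Φ : ℂ → ℝ := fun w => ‖F w‖ ^ 2 * Real.exp (-‖w‖ ^ 2) with hΦ
  have hΦi : Integrable Φ := hF.2
  set D : ℝ → ℂ → ℂ := fun r w =>
    Complex.exp ((1 - r) * α * w) * F (r * w + (1 - r) * δ) - F w with hDdef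
  have hDc : ∀ r, Continuous (D r) := fun r => by fun_prop
  have hev : ∀ᶠ r : ℝ in nhdsWithin 1 (Set.Iio 1), 1 / 2 < r ∧ r < 1 := by
    have : Set.Ioo (1 / 2 : ℝ) 1 ∈ nhdsWithin (1 : ℝ) (Set.Iio 1) :=
      Ioo_mem_nhdsLT (by norm_num)
    exact this
  have hDle : ∀ r : ℝ, 1 / 2 < r → r < 1 → ∀ w, ‖D r w‖ ^ 2 * Real.exp (-‖w‖ ^ 2) ≤
      2 * (Real.exp E * Φ (r • w + (1 - r) * δ)) + 2 * Φ w := by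
    intro r h0 h1 w
    have e1 := norm_sq_regularization_le F α δ (by linarith : 0 ≤ r) h1.le w
    have e2 := norm_sub_le (Complex.exp ((1 - r) * α * w) * F (r * w + (1 - r) * δ)) (F w)
    have e3 : ‖D r w‖ ^ 2 ≤ 2 * ‖Complex.exp ((1 - r) * α * w) * F (r * w + (1 - r) * δ)‖ ^ 2 +
        2 * ‖F w‖ ^ 2 := by
      have := pow_le_pow_left₀ (norm_nonneg _) e2 2
      refine this.trans ?_
      nlinarith [sq_nonneg (‖Complex.exp ((1 - r) * α * w) * F (r * w + (1 - r) * δ)‖ - ‖F w‖)]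
    have e4 := mul_le_mul_of_nonneg_right e3 (Real.exp_pos (-‖w‖ ^ 2)).le
    simp only [hΦ, Complex.real_smul]
    linarith
  have hshift : ∀ r : ℝ, 1 / 2 < r →
      Integrable fun w : ℂ => Φ (r • w + (1 - r) * δ) := fun r h0 =>
    (hΦi.comp_add_right ((1 - r) * δ)).comp_smul (by linarith : r ≠ 0)
  have hDi : ∀ r : ℝ, 1 / 2 < r → r < 1 →
      Integrable (fun w : ℂ => ‖D r w‖ ^ 2 * Real.exp (-‖w‖ ^ 2)) := by
    intro r h0 h1
    refine ((((hshift r h0).const_mul (Real.exp E)).const_mul 2).add (hΦi.const_mul 2)).mono'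
      ?_ (Filter.Eventually.of_forall fun w => ?_)
    · have := hDc r
      exact Continuous.aestronglyMeasurable (by fun_prop)
    · rw [Real.norm_of_nonneg (by positivity)]
      exact hDle r h0 h1 w
  have hlim : ∀ w, Filter.Tendsto (fun r => D r w) (nhdsWithin 1 (Set.Iio 1)) (nhds 0) := by
    intro w
    have hc : Continuous fun r : ℝ => D r w := by fun_prop
    have := hc.tendsto 1
    simp only [hDdef, Complex.ofReal_one, sub_self, zero_mul, Complex.exp_zero, one_mul,
      add_zero] at this
    exact this.mono_left nhdsWithin_le_nhds
  have hzero := tendsto_gaussPair_zero hch hh.2 (Filter.Eventually.of_forall hDc)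
    (hev.mono fun r hr => hDi r hr.1 hr.2)
    (M := 8 * Real.exp E * (∫ w, Φ w) + 2 * ∫ w, Φ w) (hev.mono fun r hr => ?_) hlim
  · have heq : ∀ᶠ r : ℝ in nhdsWithin 1 (Set.Iio 1),
        gaussPair (D r) h + gaussPair F h = regPair 0 α δ F h r := by
      filter_upwards [hev] with r hr
      have hr1 : ‖(r : ℂ)‖ < 1 := by
        rw [Complex.norm_real, Real.norm_of_nonneg (by linarith)]
        exact hr.2
      have i1 := integrable_regPair_integrand hF hh 0 α δ hr1
      have i2 : Integrable fun w => F w * (starRingEnd ℂ) (h w) * (Real.exp (-‖w‖ ^ 2) : ℂ) := by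
        refine (hF.2.add hh.2).mono' ?_ (Filter.Eventually.of_forall fun w => ?_)
        · have := Complex.continuous_conj
          exact Continuous.aestronglyMeasurable (by fun_prop)
        · rw [norm_mul, norm_mul, RCLike.norm_conj, Complex.norm_real,
            Real.norm_of_nonneg (Real.exp_pos _).le]
          simp only [Pi.add_apply]
          rw [← add_mul]
          gcongr
          nlinarith [sq_nonneg (‖F w‖ - ‖h w‖), sq_nonneg ‖F w‖, sq_nonneg ‖h w‖]
      rw [regPair, gaussPair, gaussPair, gaussPair, eq_comm, ← sub_eq_iff_eq_add,
        ← integral_sub i1 i2]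
      congr 1
      ext w
      simp only [hDdef, pow_zero]
      ring
    have := hzero.add_const (gaussPair F h)
    rw [zero_add] at this
    exact this.congr' heq
  · have e1 := integral_mono (hDi r hr.1 hr.2)
      ((((hshift r hr.1).const_mul (Real.exp E)).const_mul 2).add (hΦi.const_mul 2))
      (hDle r hr.1 hr.2)
    -- The Jacobian of the dilation in the real plane is r⁻², at most 4 because r > 1/2; this gives
    -- the uniform norm bound.
    have e2 : ∫ w : ℂ, Φ (r • w + (1 - r) * δ) ≤ 4 * ∫ w, Φ w := by
      have e3 := Measure.integral_comp_smul (volume : Measure ℂ)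
        (fun w => Φ (w + (1 - r) * δ)) r
      rw [e3, integral_add_right_eq_self Φ, Complex.finrank_real_complex, smul_eq_mul]
      have e4 : 0 ≤ ∫ w, Φ w := integral_nonneg fun w => by positivity
      gcongr
      rw [abs_of_nonneg (by positivity)]
      have : (1 / 2 : ℝ) ^ 2 ≤ r ^ 2 := by
        have := hr.1
        gcongr
      calc (r ^ 2)⁻¹ ≤ ((1 / 2 : ℝ) ^ 2)⁻¹ := by gcongr
        _ = 4 := by norm_num
    rw [integral_add' (((hshift r hr.1).const_mul _).const_mul 2) (hΦi.const_mul 2),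
      integral_const_mul, integral_const_mul, integral_const_mul] at e1
    have e5 : 2 * (Real.exp E * ∫ w : ℂ, Φ (r • w + (1 - r) * δ)) ≤
        2 * (Real.exp E * (4 * ∫ w, Φ w)) := by gcongr
    linarith

theorem pow_mul_mem_FockSpace_of_le {F : ℂ → ℂ} (hF : Differentiable ℂ F) {m : ℕ}
    (h : (fun w => w ^ m * F w) ∈ FockSpace) {k : ℕ} (hk : k ≤ m) :
    (fun w => w ^ k * F w) ∈ FockSpace := by
  refine ⟨by fun_prop, ?_⟩
  have hc := hF.continuous
  have hci : IntegrableOn (fun w : ℂ => ‖w ^ k * F w‖ ^ 2 * Real.exp (-‖w‖ ^ 2))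
      (Metric.closedBall 0 1) :=
    Continuous.continuousOn (by fun_prop) |>.integrableOn_compact (isCompact_closedBall 0 1)
  have hind := (hci.integrable_indicator measurableSet_closedBall)
  refine (hind.add h.2).mono' (Continuous.aestronglyMeasurable (by fun_prop))
    (Filter.Eventually.of_forall fun w => ?_)
  rw [Real.norm_of_nonneg (by positivity)]
  simp only [Pi.add_apply]
  by_cases hw : w ∈ Metric.closedBall (0 : ℂ) 1
  · rw [Set.indicator_of_mem hw]
    have : 0 ≤ ‖w ^ m * F w‖ ^ 2 * Real.exp (-‖w‖ ^ 2) := by positivity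
    linarith
  · rw [Set.indicator_of_notMem hw, zero_add, norm_mul, norm_mul, norm_pow, norm_pow]
    have h1 : 1 ≤ ‖w‖ := by
      simp only [Metric.mem_closedBall, dist_zero_right, not_le] at hw
      exact hw.le
    gcongr

/-- Expanding w^m in powers of rw + (1−r)δ attaches each power to F at the same point. This reduces
to exponent 0 applied to the Fock functions w^k F; as r → 1 only k = m keeps a nonvanishing
coefficient. -/
theorem regPair_eq_sum {F h : ℂ → ℂ} (hF : Differentiable ℂ F) {m : ℕ}
    (hFm : (fun w => w ^ m * F w) ∈ FockSpace) (hh : h ∈ FockSpace) (α δ : ℂ) {r : ℂ}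
    (hr0 : r ≠ 0) (hr : ‖r‖ < 1) :
    regPair m α δ F h r = (r ^ m)⁻¹ * ∑ k ∈ Finset.range (m + 1),
      (-((1 - r) * δ)) ^ (m - k) * m.choose k * regPair 0 α δ (fun w => w ^ k * F w) h r := by
  have hterm : ∀ k ∈ Finset.range (m + 1), Integrable fun w =>
      (-((1 - r) * δ)) ^ (m - k) * m.choose k * (w ^ 0 * Complex.exp ((1 - r) * α * w) *
      (fun w => w ^ k * F w) (r * w + (1 - r) * δ) * (starRingEnd ℂ) (h w) *
      (Real.exp (-‖w‖ ^ 2) : ℂ)) := fun k hk =>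
    (integrable_regPair_integrand (pow_mul_mem_FockSpace_of_le hF hFm
      (Nat.lt_succ_iff.1 (Finset.mem_range.1 hk))) hh 0 α δ hr).const_mul _
  simp only [regPair, gaussPair]
  simp only [← integral_const_mul]
  rw [← integral_finsetSum _ hterm, ← integral_const_mul]
  congr 1
  ext w
  have hbin : w ^ m = (r ^ m)⁻¹ * ∑ k ∈ Finset.range (m + 1),
      (r * w + (1 - r) * δ) ^ k * (-((1 - r) * δ)) ^ (m - k) * m.choose k := by
    rw [← add_pow, add_neg_cancel_right, mul_pow, inv_mul_cancel_left₀ (pow_ne_zero m hr0)]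
  rw [hbin]
  simp only [Finset.mul_sum, Finset.sum_mul, pow_zero]
  exact Finset.sum_congr rfl fun k _ => by ring

theorem tendsto_regPair {F h : ℂ → ℂ} (hF : Differentiable ℂ F) {m : ℕ}
    (hFm : (fun w => w ^ m * F w) ∈ FockSpace) (hh : h ∈ FockSpace) (α δ : ℂ) :
    Filter.Tendsto (fun r : ℝ => regPair m α δ F h r) (nhdsWithin 1 (Set.Iio 1))
      (nhds (gaussPair (fun w => w ^ m * F w) h)) := by
  have hev : ∀ᶠ r : ℝ in nhdsWithin 1 (Set.Iio 1), 0 < r ∧ r < 1 := by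
    have : Set.Ioo (0 : ℝ) 1 ∈ nhdsWithin (1 : ℝ) (Set.Iio 1) := Ioo_mem_nhdsLT (by norm_num)
    exact this
  have hr : Filter.Tendsto (fun r : ℝ => (r : ℂ)) (nhdsWithin 1 (Set.Iio 1)) (nhds 1) := by
    have := Complex.continuous_ofReal.tendsto 1
    rw [Complex.ofReal_one] at this
    exact this.mono_left nhdsWithin_le_nhds
  have hδ : Filter.Tendsto (fun r : ℝ => -((1 - (r : ℂ)) * δ)) (nhdsWithin 1 (Set.Iio 1))
      (nhds 0) := by
    have := ((hr.const_sub 1).mul_const δ).neg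
    simpa using this
  have hinv : Filter.Tendsto (fun r : ℝ => ((r : ℂ) ^ m)⁻¹) (nhdsWithin 1 (Set.Iio 1))
      (nhds 1) := by
    have := (hr.pow m).inv₀ (by simp)
    simpa using this
  have hsum := hinv.mul (tendsto_finsetSum (Finset.range (m + 1)) fun k hk =>
    ((hδ.pow (m - k)).mul_const (m.choose k : ℂ)).mul (tendsto_regPair_zero_exponent
      (pow_mul_mem_FockSpace_of_le hF hFm (Nat.lt_succ_iff.1 (Finset.mem_range.1 hk)))
      hh α δ))
  have hval : (1 : ℂ) * ∑ k ∈ Finset.range (m + 1), (0 : ℂ) ^ (m - k) * m.choose k *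
      gaussPair (fun w => w ^ k * F w) h = gaussPair (fun w => w ^ m * F w) h := by
    rw [one_mul, Finset.sum_eq_single m]
    · simp
    · intro k hk hkm
      have : m - k ≠ 0 := by
        have := Finset.mem_range.1 hk
        omega
      rw [zero_pow this, zero_mul, zero_mul]
    · simp
  rw [hval] at hsum
  refine hsum.congr' ?_
  filter_upwards [hev] with r hr01
  refine (regPair_eq_sum hF hFm hh α δ (by exact_mod_cast hr01.1.ne') ?_).symm
  rw [Complex.norm_real, Real.norm_of_nonneg hr01.1.le]
  exact hr01.2

/-! ### Algebra of the conjugation. -/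

namespace IsConjugationParam

variable {a b c : ℂ} (h : IsConjugationParam a b c)
include h

theorem a_mul_conj : a * (starRingEnd ℂ) a = 1 := by
  rw [Complex.mul_conj, Complex.normSq_eq_norm_sq, h.norm_a]
  simp

theorem a_mul_conj_b : a * (starRingEnd ℂ) b = -b := by
  linear_combination a * h.rel - b * h.a_mul_conj

theorem conj_reflection (z : ℂ) :
    (starRingEnd ℂ) (a * (starRingEnd ℂ) (a * z + b) + b) = z := by
  simp only [map_add, map_mul, Complex.conj_conj]
  linear_combination z * h.a_mul_conj + h.rel

theorem c_mul_conj : c * (starRingEnd ℂ) c * Complex.exp (b * (starRingEnd ℂ) b) = 1 := by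
  rw [Complex.mul_conj', Complex.mul_conj']
  exact_mod_cast h.norm_c

theorem wcConjFun_wcConjFun (f : ℂ → ℂ) : wcConjFun a b c (wcConjFun a b c f) = f := by
  ext z
  simp only [wcConjFun, map_mul, Complex.conj_conj, ← Complex.exp_conj, h.conj_reflection]
  have h1 : Complex.exp (b * z) * Complex.exp ((starRingEnd ℂ) b * (a * z + b)) =
      Complex.exp (b * (starRingEnd ℂ) b) := by
    rw [← Complex.exp_add]
    congr 1
    linear_combination z * h.a_mul_conj_b
  linear_combination (c * (starRingEnd ℂ) c * f z) * h1 + f z * h.c_mul_conj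

theorem measurePreserving_reflection :
    MeasurePreserving (fun z : ℂ => (starRingEnd ℂ) (a * z + b)) volume volume :=
  (Complex.conjLIE.measurePreserving.comp
    (measurePreserving_add_right (volume : Measure ℂ) b)).comp (measurePreserving_unit_mul h.norm_a)

theorem measurableEmbedding_reflection :
    MeasurableEmbedding (fun z : ℂ => (starRingEnd ℂ) (a * z + b)) := by
  have hc : Continuous fun z : ℂ => (starRingEnd ℂ) (a * z + b) :=
    Complex.continuous_conj.comp (by fun_prop)
  refine hc.measurableEmbedding fun x y hxy => ?_
  have := congrArg (fun z => (starRingEnd ℂ) (a * z + b)) hxy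
  simpa only [h.conj_reflection] using this

theorem exp_reflection (z : ℂ) :
    (starRingEnd ℂ) (Complex.exp (b * (starRingEnd ℂ) (a * z + b))) *
      (Real.exp (-‖(starRingEnd ℂ) (a * z + b)‖ ^ 2) : ℂ) =
    (starRingEnd ℂ) (Complex.exp (b * z)) * (Real.exp (-‖z‖ ^ 2) : ℂ) := by
  simp only [Complex.ofReal_exp, Complex.ofReal_neg, Complex.ofReal_pow,
    ← Complex.mul_conj', ← Complex.exp_conj, ← Complex.exp_add, map_mul, map_add,
    Complex.conj_conj]
  congr 1
  have h1 := congrArg (starRingEnd ℂ) h.a_mul_conj_b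
  simp only [map_mul, map_neg, Complex.conj_conj] at h1
  linear_combination (-z * (starRingEnd ℂ) z) * h.a_mul_conj - (starRingEnd ℂ) z * h1

/-- The bilinear form induced by the conjugation is symmetric. -/
theorem gaussPair_wcConjFun_comm (f g : ℂ → ℂ) :
    gaussPair f (wcConjFun a b c g) = gaussPair g (wcConjFun a b c f) := by
  unfold gaussPair
  rw [← h.measurePreserving_reflection.integral_comp h.measurableEmbedding_reflection]
  congr 1
  ext z
  simp only [wcConjFun, h.conj_reflection, map_mul, Complex.conj_conj]
  have h1 := h.exp_reflection z
  simp only [← Complex.exp_conj, map_mul, map_add, Complex.conj_conj] at h1 ⊢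
  linear_combination (f ((starRingEnd ℂ) a * (starRingEnd ℂ) z + (starRingEnd ℂ) b) *
    (starRingEnd ℂ) c * g z) * h1

/-- The reflection z ↦ conj(az + b) is an involution, so the zero of f at conj b is moved to 0. The
resulting factor w^m is dual to the m-th derivative. -/
theorem wcConjFun_apply_pow_mul {f k : ℂ → ℂ} {m : ℕ}
    (hf : ∀ z, f z = (a * z + b) ^ m * k z) (w : ℂ) :
    wcConjFun a b c f w = w ^ m * wcConjFun a b c k w := by
  have h1 : (starRingEnd ℂ) a * (a * w + b) + (starRingEnd ℂ) b = w := by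
    linear_combination w * h.a_mul_conj + h.rel
  simp only [wcConjFun, hf, map_mul, map_pow, map_add, Complex.conj_conj, h1]
  ring

end IsConjugationParam

/-! ### Derivative kernels and the symmetric form. -/

/-- The functions reproducing the `m`-th derivative at `y`. -/
noncomputable def derivKernel (m : ℕ) (y : ℂ) : FockSpace :=
  ⟨fun w => w ^ m * Complex.exp ((starRingEnd ℂ) y * w), by
    refine ⟨by fun_prop, ?_⟩
    refine (integrable_pow_mul_exp_mul_gauss (2 * m) (2 * ‖y‖) one_pos).mono'
      (Continuous.aestronglyMeasurable (by fun_prop)) (Filter.Eventually.of_forall fun w => ?_)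
    have h1 : ‖Complex.exp ((starRingEnd ℂ) y * w)‖ ≤ Real.exp (‖y‖ * ‖w‖) := by
      simpa using norm_cexp_le ((starRingEnd ℂ) y * w)
    rw [Real.norm_of_nonneg (by positivity), norm_mul, norm_pow, mul_pow, ← pow_mul, neg_mul,
      one_mul, mul_comm m 2]
    have h2 : Real.exp (2 * ‖y‖ * ‖w‖) = Real.exp (‖y‖ * ‖w‖) ^ 2 := by
      rw [← Real.exp_nat_mul]
      push_cast
      ring_nf
    rw [h2]
    gcongr⟩

theorem gaussPair_derivKernel {f : ℂ → ℂ} (hf : f ∈ FockSpace) (m : ℕ) (y : ℂ) :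
    gaussPair f (derivKernel m y).1 = Real.pi * iteratedDeriv m f y := by
  rw [← integral_kernel_eq_iteratedDeriv hf]
  unfold gaussPair derivKernel
  congr 1
  ext w
  simp only [map_mul, map_pow, ← Complex.exp_conj, Complex.conj_conj]
  ring

theorem fockInner_eq (f g : FockSpace) : fockInner f g = 1 / (Real.pi : ℂ) * gaussPair f.1 g.1 :=
  rfl

theorem wcConjFun_derivKernel {a b c : ℂ} (m : ℕ) (y z : ℂ) :
    wcConjFun a b c (derivKernel m y).1 z =
      c * (a * z + b) ^ m * Complex.exp (b * z + y * (a * z + b)) := by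
  simp only [wcConjFun, derivKernel, map_mul, map_pow, ← Complex.exp_conj, Complex.conj_conj]
  rw [Complex.exp_add]
  ring

theorem fockInner_wcConj_wcConj_derivKernel {a b c : ℂ} (h : IsConjugationParam a b c)
    (f : FockSpace) (m : ℕ) (y : ℂ) :
    fockInner f (wcConj h (wcConj h (derivKernel m y))) = iteratedDeriv m f.1 y := by
  rw [fockInner_eq]
  change 1 / (Real.pi : ℂ) *
    gaussPair f.1 (wcConjFun a b c (wcConjFun a b c (derivKernel m y).1)) = _
  rw [h.wcConjFun_wcConjFun, gaussPair_derivKernel f.2]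
  have hpi : (Real.pi : ℂ) ≠ 0 := by exact_mod_cast Real.pi_ne_zero
  field_simp

theorem fockInner_wcConj_comm {a b c : ℂ} (h : IsConjugationParam a b c) (f g : FockSpace) :
    fockInner f (wcConj h g) = fockInner g (wcConj h f) := by
  rw [fockInner_eq, fockInner_eq]
  exact congrArg _ (h.gaussPair_wcConjFun_comm f.1 g.1)

theorem gaussPair_conj (f g : ℂ → ℂ) :
    (starRingEnd ℂ) (gaussPair f g) = gaussPair g f := by
  unfold gaussPair
  rw [← integral_conj]
  congr 1
  ext z
  simp only [map_mul, Complex.conj_conj, Complex.conj_ofReal]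
  ring

theorem gaussPair_const_mul_left (k : ℂ) (f g : ℂ → ℂ) :
    gaussPair (fun z => k * f z) g = k * gaussPair f g := by
  unfold gaussPair
  rw [← integral_const_mul]
  simp only [mul_assoc]

theorem gaussPair_const_mul_right (k : ℂ) (f g : ℂ → ℂ) :
    gaussPair f (fun z => k * g z) = (starRingEnd ℂ) k * gaussPair f g := by
  rw [← gaussPair_conj, gaussPair_const_mul_left, map_mul, gaussPair_conj]

theorem differentiable_wcConjFun (a b c : ℂ) {f : ℂ → ℂ} (hf : Differentiable ℂ f) :
    Differentiable ℂ (wcConjFun a b c f) := by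
  have h1 : Differentiable ℂ (fun w : ℂ => (starRingEnd ℂ) (f ((starRingEnd ℂ) w))) :=
    fun w => differentiableAt_conj_conj_iff.2 (hf ((starRingEnd ℂ) w))
  have h2 : Differentiable ℂ (fun z : ℂ => a * z + b) := by fun_prop
  have h3 : Differentiable ℂ (fun z : ℂ => c * Complex.exp (b * z)) := by fun_prop
  exact h3.mul (h1.comp h2)

/-! ### Symmetry of the form on the maximal graph. -/

theorem regPair_eq_conj_gaussPair {g k : ℂ → ℂ} (hg : g ∈ FockSpace) (hk : k ∈ FockSpace)
    (m : ℕ) (γ D : ℂ) {r : ℝ} (hr0 : 0 < r) (hr1 : r < 1) :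
    regPair m ((starRingEnd ℂ) γ) ((starRingEnd ℂ) D) k g r = (starRingEnd ℂ)
      (gaussPair (fun z => Complex.exp ((1 - r) * D * z) *
        iteratedDeriv m g (r * z + (1 - r) * γ)) k) := by
  have hr : ‖(r : ℂ)‖ < 1 := by
    rwa [Complex.norm_real, Real.norm_of_nonneg hr0.le]
  rw [gaussPair_weighted_comp_iteratedDeriv hg hk m hr, gaussPair_conj]
  simp only [regPair, map_mul, map_sub, map_one, Complex.conj_ofReal]

namespace IsConjugationParam

variable {a b c : ℂ} (h : IsConjugationParam a b c)
include h

theorem mem_FockSpace_of_pow_mul {f k : ℂ → ℂ} {m : ℕ} (hf : f ∈ FockSpace)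
    (hk : Differentiable ℂ k) (hfk : ∀ z, f z = (a * z + b) ^ m * k z) :
    (fun w => w ^ m * wcConjFun a b c k w) ∈ FockSpace ∧ wcConjFun a b c k ∈ FockSpace ∧
      k ∈ FockSpace := by
  have h1 : (fun w => w ^ m * wcConjFun a b c k w) ∈ FockSpace := by
    have := wcConjFun_mem h hf
    rwa [funext (h.wcConjFun_apply_pow_mul hfk)] at this
  have h2 : wcConjFun a b c k ∈ FockSpace := by
    have := pow_mul_mem_FockSpace_of_le (differentiable_wcConjFun a b c hk) h1 (Nat.zero_le m)
    simpa using this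
  refine ⟨h1, h2, ?_⟩
  have := wcConjFun_mem h h2
  rwa [h.wcConjFun_wcConjFun] at this

/-- The weighted composition operator `f ↦ C exp (D ·) f (A · + B)` is symmetric up to
a contraction of the plane towards the fixed point of the conjugation. -/
theorem gaussPair_weighted_comp_contraction {f u : ℂ → ℂ} (hf : f ∈ FockSpace)
    (hu : u ∈ FockSpace) {A B D : ℂ} (C : ℂ) (hD : D = b + a * B - b * A) {r : ℝ}
    (hr : ‖A * r‖ < 1) :
    gaussPair (fun z => C * Complex.exp (D * (r * z + (1 - r) * (starRingEnd ℂ) b)) *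
      f (A * (r * z + (1 - r) * (starRingEnd ℂ) b) + B)) (wcConjFun a b c u) =
    gaussPair (fun z => C * Complex.exp (D * z) *
      u (r * (A * z + B) + (1 - r) * (starRingEnd ℂ) b)) (wcConjFun a b c f) := by
  have hadj := gaussPair_weighted_comp_iteratedDeriv hf (wcConjFun_mem h hu) 0 hr (D * r)
    (A * ((1 - r) * (starRingEnd ℂ) b) + B)
  have hleft : (fun z => C * Complex.exp (D * (r * z + (1 - r) * (starRingEnd ℂ) b)) *
      f (A * (r * z + (1 - r) * (starRingEnd ℂ) b) + B)) =
      fun z => (C * Complex.exp (D * ((1 - r) * (starRingEnd ℂ) b))) *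
        (Complex.exp (D * r * z) * iteratedDeriv 0 f (A * r * z +
          (A * ((1 - r) * (starRingEnd ℂ) b) + B))) := by
    ext z
    rw [iteratedDeriv_zero, mul_add D, Complex.exp_add]
    ring_nf
  rw [hleft, gaussPair_const_mul_left, hadj, h.gaussPair_wcConjFun_comm, ← Complex.conj_conj
    (C * Complex.exp (D * ((1 - r) * (starRingEnd ℂ) b))), ← gaussPair_const_mul_right]
  congr 1
  ext w
  have h1 : a * (starRingEnd ℂ) D = -b + (starRingEnd ℂ) B + b * (starRingEnd ℂ) A := by
    rw [hD]
    simp only [map_sub, map_add, map_mul]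
    linear_combination h.a_mul_conj_b + (starRingEnd ℂ) B * h.a_mul_conj -
      (starRingEnd ℂ) A * h.a_mul_conj_b
  have h2 : (starRingEnd ℂ) a * D =
      -(starRingEnd ℂ) b + B + (starRingEnd ℂ) b * A := by
    simpa using congrArg (starRingEnd ℂ) h1
  have hexp : (starRingEnd ℂ) D * ((1 - r) * b) + (starRingEnd ℂ)
      (A * ((1 - r) * (starRingEnd ℂ) b) + B) * w +
      b * ((starRingEnd ℂ) (A * r) * w + (starRingEnd ℂ) (D * r)) =
      b * w + (starRingEnd ℂ) D * (a * w + b) := by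
    simp only [map_mul, map_add, map_sub, map_one, Complex.conj_conj, Complex.conj_ofReal]
    linear_combination (-w) * h1
  have harg : (starRingEnd ℂ) (a * ((starRingEnd ℂ) (A * r) * w + (starRingEnd ℂ) (D * r)) + b) =
      r * (A * (starRingEnd ℂ) (a * w + b) + B) + (1 - r) * (starRingEnd ℂ) b := by
    simp only [map_mul, map_add, Complex.conj_conj, Complex.conj_ofReal]
    linear_combination (r : ℂ) * h2
  simp only [wcConjFun, harg]
  have hE := congrArg Complex.exp hexp
  rw [Complex.exp_add, Complex.exp_add, Complex.exp_add] at hE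
  simp only [map_mul, ← Complex.exp_conj, map_sub, map_one, Complex.conj_conj,
    Complex.conj_ofReal, pow_zero, one_mul] at hE ⊢
  linear_combination (c * (starRingEnd ℂ) C * (starRingEnd ℂ)
    (u (r * (A * (starRingEnd ℂ) (a * w + b) + B) + (1 - r) * (starRingEnd ℂ) b))) * hE

theorem gaussPair_wcConjFun_eq_of_factor {f g u v f₁ u₁ : ℂ → ℂ} {m : ℕ} (hf : f ∈ FockSpace)
    (hg : g ∈ FockSpace) (hu : u ∈ FockSpace) (hv : v ∈ FockSpace)
    (hf₁ : Differentiable ℂ f₁) (hu₁ : Differentiable ℂ u₁)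
    (hff : ∀ z, f z = (a * z + b) ^ m * f₁ z) (huu : ∀ z, u z = (a * z + b) ^ m * u₁ z)
    {A B C D : ℂ} (hA : A ≠ 0) (hD : D = b + a * B - b * A)
    (hgf : ∀ y, iteratedDeriv m g y = C * Complex.exp (D * y) * f₁ (A * y + B))
    (hvu : ∀ y, iteratedDeriv m v y = C * Complex.exp (D * y) * u₁ (A * y + B)) :
    gaussPair g (wcConjFun a b c u) = gaussPair v (wcConjFun a b c f) := by
  obtain ⟨hf2, hf3, hf4⟩ := h.mem_FockSpace_of_pow_mul hf hf₁ hff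
  obtain ⟨hu2, hu3, hu4⟩ := h.mem_FockSpace_of_pow_mul hu hu₁ huu
  -- The affine map sends γ to conj b, the zero of az + b. Contracting the argument of v^(m) towards
  -- γ thus contracts that of u₁ towards conj b, matching the regularization of g^(m).
  set γ : ℂ := ((starRingEnd ℂ) b - B) / A with hγ
  have hAγ : A * γ + B = (starRingEnd ℂ) b := by
    rw [hγ]
    field_simp
    ring
  set P : ℂ → ℂ := regPair m b 0 (wcConjFun a b c u₁) g with hP
  -- The prefactor restores the full weight e^{Dz}: v^(m) at the contracted point supplies only
  -- e^{D(rz + (1−r)γ)}. It tends to 1 as r → 1.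
  set Q : ℂ → ℂ := fun r =>
    Complex.exp (-((1 - r) * (starRingEnd ℂ) (D * γ))) *
    regPair m ((starRingEnd ℂ) γ) ((starRingEnd ℂ) D) (wcConjFun a b c f₁) v r with hQ
  have hPd : AnalyticOnNhd ℂ P (Metric.ball 0 1) :=
    (differentiableOn_regPair hu3 hg m b 0).analyticOnNhd Metric.isOpen_ball
  have hQd : AnalyticOnNhd ℂ Q (Metric.ball 0 1) := by
    refine DifferentiableOn.analyticOnNhd (DifferentiableOn.mul ?_
      (differentiableOn_regPair hf3 hv m _ _)) Metric.isOpen_ball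
    exact Differentiable.differentiableOn (by fun_prop)
  have hPreal : ∀ r : ℝ, 0 < r → r < 1 → P r = (starRingEnd ℂ)
      (gaussPair (fun z => C * Complex.exp (D * (r * z + (1 - r) * (starRingEnd ℂ) b)) *
        f₁ (A * (r * z + (1 - r) * (starRingEnd ℂ) b) + B)) (wcConjFun a b c u₁)) := by
    intro r h0 h1
    have := regPair_eq_conj_gaussPair hg hu3 m ((starRingEnd ℂ) b) 0 h0 h1
    simpa [hgf] using this
  have hQreal : ∀ r : ℝ, 0 < r → r < 1 → Q r = (starRingEnd ℂ)
      (gaussPair (fun z => C * Complex.exp (D * z) *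
        u₁ (r * (A * z + B) + (1 - r) * (starRingEnd ℂ) b)) (wcConjFun a b c f₁)) := by
    intro r h0 h1
    have h2 : ∀ z : ℂ, C * Complex.exp (D * z) *
        u₁ (r * (A * z + B) + (1 - r) * (starRingEnd ℂ) b) =
        Complex.exp (-((1 - r) * (D * γ))) * (Complex.exp ((1 - r) * D * z) *
          iteratedDeriv m v (r * z + (1 - r) * γ)) := by
      intro z
      have h3 : A * (r * z + (1 - r) * γ) + B =
          r * (A * z + B) + (1 - r) * (starRingEnd ℂ) b := by
        linear_combination (1 - r : ℂ) * hAγ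
      have h4 : Complex.exp (D * z) = Complex.exp (-((1 - r) * (D * γ))) *
          Complex.exp ((1 - r) * D * z) * Complex.exp (D * (r * z + (1 - r) * γ)) := by
        rw [← Complex.exp_add, ← Complex.exp_add]
        ring_nf
      rw [hvu, h3, h4]
      ring
    simp only [h2]
    rw [gaussPair_const_mul_left, map_mul, ← regPair_eq_conj_gaussPair hv hf3 m γ D h0 h1,
      ← Complex.exp_conj]
    simp [hQ]
  have hreal : ∀ r : ℝ, 0 < r → r < 1 → ‖A * r‖ < 1 → P r = Q r := fun r h0 h1 h2 => by
    rw [hPreal r h0 h1, hQreal r h0 h1,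
      h.gaussPair_weighted_comp_contraction hf4 hu4 C hD h2]
  have hsmall : ∀ᶠ r : ℝ in nhdsWithin 0 (Set.Ioi 0), P r = Q r := by
    have e1 : ∀ᶠ r : ℝ in nhdsWithin 0 (Set.Ioi 0), 0 < r ∧ r < 1 :=
      Ioo_mem_nhdsGT one_pos
    have e2 : ∀ᶠ r : ℝ in nhdsWithin 0 (Set.Ioi 0), ‖A * (r : ℂ)‖ < 1 := by
      have hc : Continuous fun r : ℝ => ‖A * (r : ℂ)‖ := by fun_prop
      have := (hc.tendsto 0).mono_left (nhdsWithin_le_nhds (s := Set.Ioi 0))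
      exact this.eventually (gt_mem_nhds (by simp))
    filter_upwards [e1, e2] with r h1 h2 using hreal r h1.1 h1.2 h2
  have hfreq : ∃ᶠ z in nhdsWithin (0 : ℂ) {0}ᶜ, P z = Q z := by
    have ht : Filter.Tendsto (fun r : ℝ => (r : ℂ)) (nhdsWithin 0 (Set.Ioi 0))
        (nhdsWithin (0 : ℂ) {0}ᶜ) := by
      refine tendsto_nhdsWithin_of_tendsto_nhds_of_eventually_within _ ?_ ?_
      · have := Complex.continuous_ofReal.tendsto 0
        rw [Complex.ofReal_zero] at this
        exact this.mono_left nhdsWithin_le_nhds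
      · filter_upwards [self_mem_nhdsWithin] with r hr
        simpa using (ne_of_gt hr)
    exact ht.frequently hsmall.frequently
  have heq := hPd.eqOn_of_preconnected_of_frequently_eq hQd
    (convex_ball (0 : ℂ) 1).isPreconnected (Metric.mem_ball_self one_pos) hfreq
  have hPlim := tendsto_regPair (differentiable_wcConjFun a b c hu₁) hu2 hg b 0
  have hQlim : Filter.Tendsto (fun r : ℝ => Q r) (nhdsWithin 1 (Set.Iio 1))
      (nhds (1 * gaussPair (fun w => w ^ m * wcConjFun a b c f₁ w) v)) := by
    refine Filter.Tendsto.mul ?_ (tendsto_regPair (differentiable_wcConjFun a b c hf₁) hf2 hv _ _)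
    have hc : Continuous fun r : ℝ =>
        Complex.exp (-((1 - (r : ℂ)) * (starRingEnd ℂ) (D * γ))) := by fun_prop
    have := (hc.tendsto 1).mono_left (nhdsWithin_le_nhds (s := Set.Iio 1))
    simpa using this
  have hfin := tendsto_nhds_unique (hPlim.congr' ?_) hQlim
  · rw [one_mul, ← funext (h.wcConjFun_apply_pow_mul hff),
      ← funext (h.wcConjFun_apply_pow_mul huu)] at hfin
    have := congrArg (starRingEnd ℂ) hfin
    rwa [gaussPair_conj, gaussPair_conj] at this
  · have : Set.Ioo (0 : ℝ) 1 ∈ nhdsWithin (1 : ℝ) (Set.Iio 1) := Ioo_mem_nhdsLT one_pos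
    filter_upwards [this] with r hr
    refine heq ?_
    rw [Metric.mem_ball, dist_zero_right, Complex.norm_real, Real.norm_of_nonneg hr.1.le]
    exact hr.2

end IsConjugationParam

namespace IsConjugationParam

variable {a b c : ℂ} (h : IsConjugationParam a b c)
include h

theorem gaussPair_wcConjFun_eq {f g u v : ℂ → ℂ} {m : ℕ} (hf : f ∈ FockSpace)
    (hg : g ∈ FockSpace) (hu : u ∈ FockSpace) (hv : v ∈ FockSpace) {A B C D : ℂ} (hC : C ≠ 0)
    (hD : D = b + a * B - b * A) (hmA : m ≠ 0 → A ≠ 0)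
    (hfg : ∀ y, C * Complex.exp (D * y) * f (A * y + B) =
      (a * (A * y + B) + b) ^ m * iteratedDeriv m g y)
    (huv : ∀ y, C * Complex.exp (D * y) * u (A * y + B) =
      (a * (A * y + B) + b) ^ m * iteratedDeriv m v y) :
    gaussPair g (wcConjFun a b c u) = gaussPair f (wcConjFun a b c v) := by
  rw [h.gaussPair_wcConjFun_comm f v]
  -- When A = 0 the contraction condition already holds at r = 1, so no limit is needed.
  by_cases hA : A = 0
  · have hm : m = 0 := by
      by_contra hm
      exact hmA hm hA
    subst hm
    subst hA
    simp only [pow_zero, one_mul, iteratedDeriv_zero] at hfg huv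
    have := h.gaussPair_weighted_comp_contraction hf hu C hD (r := 1) (by simp)
    rw [show g = fun z => C * Complex.exp (D * z) * f B by ext z; simp [← hfg],
      show v = fun z => C * Complex.exp (D * z) * u B by ext z; simp [← huv]]
    simpa using this
  · have hdiv : ∀ {p q : ℂ → ℂ}, q ∈ FockSpace →
        (∀ y, C * Complex.exp (D * y) * p (A * y + B) =
          (a * (A * y + B) + b) ^ m * iteratedDeriv m q y) →
        ∃ k : ℂ → ℂ, Differentiable ℂ k ∧ (∀ z, p z = (a * z + b) ^ m * k z) ∧
          ∀ y, iteratedDeriv m q y = C * Complex.exp (D * y) * k (A * y + B) := by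
      intro p q hq hpq
      -- The quotient is read off from q^(m) through the inverse affine map, so it is entire without
      -- any argument about zeros.
      refine ⟨fun z => C⁻¹ * Complex.exp (-(D * ((z - B) / A))) *
        iteratedDeriv m q ((z - B) / A), ?_, fun z => ?_, fun y => ?_⟩
      · have h1 : Differentiable ℂ (iteratedDeriv m q) := by
          have h2 : ContDiff ℂ (m + 1 : ℕ) q := hq.1.contDiff
          exact h2.differentiable_iteratedDeriv m (by exact_mod_cast m.lt_succ_self)
        have h3 : Differentiable ℂ fun z : ℂ => iteratedDeriv m q ((z - B) / A) :=
          h1.comp (by fun_prop)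
        fun_prop
      · have h1 := hpq ((z - B) / A)
        have h2 : A * ((z - B) / A) + B = z := by
          field_simp
          ring
        have h3 := Complex.exp_ne_zero (D * ((z - B) / A))
        rw [h2] at h1
        simp only [Complex.exp_neg]
        calc p z = C⁻¹ * (Complex.exp (D * ((z - B) / A)))⁻¹ *
              (C * Complex.exp (D * ((z - B) / A)) * p z) := by
              field_simp
          _ = _ := by
              rw [h1]
              ring
      · have h2 : (A * y + B - B) / A = y := by
          field_simp
          ring
        have h3 := Complex.exp_ne_zero (D * y)
        simp only [h2, Complex.exp_neg]
        field_simp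
    obtain ⟨f₁, hf₁, hff, hgf⟩ := hdiv hg hfg
    obtain ⟨u₁, hu₁, huu, hvu⟩ := hdiv hv huv
    exact h.gaussPair_wcConjFun_eq_of_factor hf hg hu hv hf₁ hu₁ hff huu hA hD hgf hvu

theorem fockInner_wcConj_smul_wcConj_derivKernel (f : FockSpace) (k : ℂ) (m : ℕ) (y : ℂ) :
    fockInner f (wcConj h (k • wcConj h (derivKernel m y))) = k * iteratedDeriv m f.1 y := by
  rw [fockInner_wcConj_comm, ← fockInner_wcConj_wcConj_derivKernel h f m y,
    fockInner_wcConj_comm h f]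
  have := gaussPair_const_mul_left k (wcConj h (derivKernel m y)).1 (wcConj h f).1
  rw [fockInner_eq, fockInner_eq, mul_left_comm, ← this]
  rfl

/-- Both sides are the symmetric form evaluated on the same two kernels. -/
theorem iteratedDeriv_wcConjFun_derivKernel_zero (m : ℕ) (y z : ℂ) :
    iteratedDeriv m (wcConjFun a b c (derivKernel 0 y).1) z =
      wcConjFun a b c (derivKernel m z).1 y := by
  have h1 := fockInner_wcConj_wcConj_derivKernel h (wcConj h (derivKernel 0 y)) m z
  rw [fockInner_wcConj_comm, fockInner_wcConj_wcConj_derivKernel, iteratedDeriv_zero] at h1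
  exact h1.symm

end IsConjugationParam

/-! ### Duality with kernel pairs and the functional equation. -/

/-- The elements of the graph that determine the maximal operator by duality. -/
noncomputable def kernelPair {a b c : ℂ} (h : IsConjugationParam a b c) (m : ℕ)
    (psi varphi phi : ℂ → ℂ) (y : ℂ) : FockSpace × FockSpace :=
  (phi y • wcConj h (derivKernel m y), psi y • wcConj h (derivKernel 0 (varphi y)))

theorem mem_maxWCO_iff_kernelPair {a b c : ℂ} (h : IsConjugationParam a b c) (m : ℕ)
    (psi varphi phi : ℂ → ℂ) (p : FockSpace × FockSpace) :
    p ∈ maxWCO m psi varphi phi ↔ ∀ y,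
      fockInner p.2 (wcConj h (kernelPair h m psi varphi phi y).1) =
      fockInner p.1 (wcConj h (kernelPair h m psi varphi phi y).2) := by
  simp only [kernelPair, h.fockInner_wcConj_smul_wcConj_derivKernel, iteratedDeriv_zero]
  exact forall_congr' fun y => eq_comm

theorem kernelPair_mem_maxWCO_iff {a b c : ℂ} (h : IsConjugationParam a b c) (m : ℕ)
    (psi varphi phi : ℂ → ℂ) (y : ℂ) :
    kernelPair h m psi varphi phi y ∈ maxWCO m psi varphi phi ↔ ∀ z,
      psi z * (a * varphi z + b) ^ m * phi y *
        Complex.exp (b * varphi z + y * (a * varphi z + b)) =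
      psi y * (a * varphi y + b) ^ m * phi z *
        Complex.exp (b * varphi y + z * (a * varphi y + b)) := by
  have hc : c ≠ 0 := by
    rintro rfl
    simpa using h.norm_c
  refine forall_congr' fun z => ?_
  have h1 : iteratedDeriv m (kernelPair h m psi varphi phi y).2.1 z =
      psi y * wcConjFun a b c (derivKernel m z).1 (varphi y) := by
    rw [← h.iteratedDeriv_wcConjFun_derivKernel_zero]
    have h2 : ((kernelPair h m psi varphi phi y).2.1 : ℂ → ℂ) =
      psi y • wcConjFun a b c (derivKernel 0 (varphi y)).1 := rfl
    have h3 : ContDiffAt ℂ m (wcConjFun a b c (derivKernel 0 (varphi y)).1) z :=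
      (wcConjFun_mem h (derivKernel 0 (varphi y)).2).1.contDiff.contDiffAt
    rw [h2, iteratedDeriv_const_smul h3, smul_eq_mul]
  have h4 : (kernelPair h m psi varphi phi y).1.1 (varphi z) =
      phi y * wcConjFun a b c (derivKernel m y).1 (varphi z) := rfl
  rw [h1, h4, wcConjFun_derivKernel, wcConjFun_derivKernel]
  constructor
  · intro e
    refine mul_left_cancel₀ hc ?_
    linear_combination e
  · intro e
    linear_combination c * e

/-- Solution of the functional equation satisfied by the symbols. -/
theorem exists_affine_of_kernel_equation {a b : ℂ} (ha : a ≠ 0) {m : ℕ} {psi varphi phi : ℂ → ℂ}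
    (hpsi : Differentiable ℂ psi) (hvarphi : Differentiable ℂ varphi)
    (hphi : Differentiable ℂ phi) (hpsi0 : ∀ z, psi z ≠ 0) (hphi0 : ∃ z, phi z ≠ 0)
    (hconst : m ≠ 0 → ∃ z w, varphi z ≠ varphi w)
    (heq : ∀ y z, psi z * (a * varphi z + b) ^ m * phi y *
        Complex.exp (b * varphi z + y * (a * varphi z + b)) =
      psi y * (a * varphi y + b) ^ m * phi z *
        Complex.exp (b * varphi y + z * (a * varphi y + b))) :
    ∃ A B C D : ℂ, C ≠ 0 ∧ D = b + a * B - b * A ∧ (∀ y, varphi y = A * y + B) ∧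
      (∀ y, C * Complex.exp (D * y) * phi y = psi y * (a * (A * y + B) + b) ^ m) := by
  set H : ℂ → ℂ := fun z => psi z * (a * varphi z + b) ^ m with hH
  have hHd : Differentiable ℂ H := by fun_prop
  have hE : ∀ y z, H z * phi y * Complex.exp (b * varphi z + y * (a * varphi z + b)) =
      H y * phi z * Complex.exp (b * varphi y + z * (a * varphi y + b)) := heq
  have hH0 : ∃ z, H z ≠ 0 := by
    by_cases hm : m = 0
    · exact ⟨0, by simp [hH, hm, hpsi0]⟩
    · obtain ⟨z, w, hzw⟩ := hconst hm
      by_contra hne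
      have hzero : ∀ z, a * varphi z + b = 0 := fun z => by
        have hz : H z = 0 := by
          by_contra hz
          exact hne ⟨z, hz⟩
        exact eq_zero_of_pow_eq_zero ((mul_eq_zero.1 hz).resolve_left (hpsi0 z))
      exact hzw (mul_left_cancel₀ ha (by linear_combination hzero z - hzero w))
  obtain ⟨z₀, hz₀⟩ := hH0
  obtain ⟨y₁, hy₁⟩ := hphi0
  have hH₁ : H y₁ ≠ 0 := by
    intro h0
    have := hE y₁ z₀
    rw [h0, zero_mul, zero_mul] at this
    exact mul_ne_zero (mul_ne_zero hz₀ hy₁) (Complex.exp_ne_zero _) this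
  have hgood : ∀ᶠ z in nhds y₁, H z ≠ 0 ∧ phi z ≠ 0 :=
    (hHd.continuous.continuousAt.eventually_ne hH₁).and
      (hphi.continuous.continuousAt.eventually_ne hy₁)
  -- Comparing the equation at two distinct parameters y₀, y₁ eliminates H(z) and phi(z), leaving an
  -- exponential identity for varphi alone.
  obtain ⟨y₀, ⟨hH₀, hy₀⟩, hne⟩ : ∃ y₀, (H y₀ ≠ 0 ∧ phi y₀ ≠ 0) ∧ y₀ ≠ y₁ :=
    ((hgood.filter_mono nhdsWithin_le_nhds).and
      (eventually_mem_nhdsWithin (a := y₁) (s := {y₁}ᶜ))).exists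
  have haff : ∃ A B : ℂ, ∀ z, varphi z = A * z + B := by
    set L : ℂ → ℂ := fun z => a * (y₀ - y₁) * varphi z - a * (varphi y₀ - varphi y₁) * z with hL
    have hLd : Differentiable ℂ L := by fun_prop
    set κ : ℂ := H y₀ * phi y₁ / (phi y₀ * H y₁) *
      Complex.exp (b * varphi y₀ - b * varphi y₁ + y₁ * b - y₀ * b) with hκ
    have hLκ : ∀ z, H z ≠ 0 ∧ phi z ≠ 0 → Complex.exp (L z) = κ := by
      rintro z ⟨hHz, hz⟩
      have e0 := hE y₀ z
      have e1 := hE y₁ z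
      set X := Complex.exp (b * varphi z + y₀ * (a * varphi z + b))
      set Y := Complex.exp (b * varphi y₀ + z * (a * varphi y₀ + b)) with hY
      set X' := Complex.exp (b * varphi z + y₁ * (a * varphi z + b)) with hX'
      set Y' := Complex.exp (b * varphi y₁ + z * (a * varphi y₁ + b))
      have hYn : Y ≠ 0 := Complex.exp_ne_zero _
      have hXn : X' ≠ 0 := Complex.exp_ne_zero _
      have e2 : Complex.exp (L z) * (X' * Y) = X * Y' *
          Complex.exp (b * varphi y₀ - b * varphi y₁ + y₁ * b - y₀ * b) := by
        simp only [X, Y, X', Y', ← Complex.exp_add]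
        congr 1
        simp only [hL]
        ring
      have e3 : (X * Y') * (phi y₀ * H y₁) = (H y₀ * phi y₁) * (X' * Y) := by
        refine mul_left_cancel₀ (mul_ne_zero hHz hz) ?_
        linear_combination (H y₁ * phi z * Y') * e0 - (H y₀ * phi z * Y) * e1
      refine mul_right_cancel₀ (mul_ne_zero hXn hYn) ?_
      rw [e2, hκ]
      have h5 : X * Y' = (H y₀ * phi y₁) / (phi y₀ * H y₁) * (X' * Y) := by
        rw [div_mul_eq_mul_div, eq_div_iff (mul_ne_zero hy₀ hH₁), e3]
      rw [h5]
      ring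
    -- Since e^L is locally constant, differentiating gives L' = 0 near y₁ without choosing a
    -- logarithm; analyticity extends this to the plane.
    have hLder : ∀ᶠ z in nhds y₁, deriv L z = 0 := by
      filter_upwards [hgood.eventually_nhds] with z hz
      have h1 : (fun w => Complex.exp (L w)) =ᶠ[nhds z] fun _ => κ :=
        hz.mono fun w hw => hLκ w hw
      have h2 := h1.deriv_eq
      rw [deriv_const, deriv_cexp (hLd z)] at h2
      exact (mul_eq_zero.1 h2).resolve_left (Complex.exp_ne_zero _)
    have hLder' : deriv L = fun _ => 0 := by
      have h1 : AnalyticOnNhd ℂ (deriv L) Set.univ :=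
        (hLd.differentiableOn.analyticOnNhd isOpen_univ).deriv
      exact h1.eq_of_eventuallyEq (g := fun _ => 0) analyticOnNhd_const hLder
    have hLc := fun z => is_const_of_deriv_eq_zero hLd (fun w => congrFun hLder' w) z 0
    have hay : a * (y₀ - y₁) ≠ 0 := mul_ne_zero ha (sub_ne_zero.2 hne)
    refine ⟨(varphi y₀ - varphi y₁) / (y₀ - y₁), varphi 0, fun z => ?_⟩
    have h3 := hLc z
    simp only [hL] at h3
    refine mul_left_cancel₀ hay ?_
    have h4 := sub_ne_zero.2 hne
    have h5 : a * (y₀ - y₁) * ((varphi y₀ - varphi y₁) / (y₀ - y₁) * z + varphi 0) =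
        a * (varphi y₀ - varphi y₁) * z + a * (y₀ - y₁) * varphi 0 := by
      field_simp
    rw [h5]
    linear_combination h3
  obtain ⟨A, B, hAB⟩ := haff
  -- C is forced by the required identity at y = y₁, and D is the coefficient of y − y₁ in the
  -- difference of the two exponents.
  refine ⟨A, B, H y₁ / phi y₁ * Complex.exp (-(b + a * B - b * A) * y₁), b + a * B - b * A,
    mul_ne_zero (div_ne_zero hH₁ hy₁) (Complex.exp_ne_zero _), rfl, hAB, fun y => ?_⟩
  have e := hE y₁ y
  have hHy : H y = psi y * (a * (A * y + B) + b) ^ m := by rw [← hAB y]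
  rw [← hHy]
  simp only [hAB] at e
  set X := Complex.exp (b * (A * y + B) + y₁ * (a * (A * y + B) + b)) with hX
  have hXn : X ≠ 0 := Complex.exp_ne_zero _
  have e1 : Complex.exp (-(b + a * B - b * A) * y₁) * Complex.exp ((b + a * B - b * A) * y) * X =
      Complex.exp (b * (A * y₁ + B) + y * (a * (A * y₁ + B) + b)) := by
    rw [hX, ← Complex.exp_add, ← Complex.exp_add]
    ring_nf
  rw [← e1] at e
  refine mul_right_cancel₀ (mul_ne_zero hXn hy₁) ?_
  have h6 : H y₁ / phi y₁ * phi y₁ = H y₁ := div_mul_cancel₀ _ hy₁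
  linear_combination (Complex.exp (-(b + a * B - b * A) * y₁) *
    Complex.exp ((b + a * B - b * A) * y) * X * phi y) * h6 - e

theorem kernel_equation_of_affine {a b : ℂ} {m : ℕ} {psi varphi phi : ℂ → ℂ} {A B C D : ℂ}
    (hD : D = b + a * B - b * A) (hAB : ∀ y, varphi y = A * y + B)
    (hphi : ∀ y, C * Complex.exp (D * y) * phi y = psi y * (a * (A * y + B) + b) ^ m) (y z : ℂ) :
    psi z * (a * varphi z + b) ^ m * phi y *
        Complex.exp (b * varphi z + y * (a * varphi z + b)) =
      psi y * (a * varphi y + b) ^ m * phi z *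
        Complex.exp (b * varphi y + z * (a * varphi y + b)) := by
  rw [hAB, hAB, ← hphi, ← hphi]
  have h1 : Complex.exp (D * z) * Complex.exp (b * (A * z + B) + y * (a * (A * z + B) + b)) =
      Complex.exp (D * y) * Complex.exp (b * (A * y + B) + z * (a * (A * y + B) + b)) := by
    rw [← Complex.exp_add, ← Complex.exp_add, hD]
    ring_nf
  linear_combination (C * phi z * phi y) * h1

/-! ### The characterization of selfadjointness. -/

theorem fockInner_wcConj_eq_of_mem_maxWCO {a b c : ℂ} (h : IsConjugationParam a b c) {m : ℕ}
    {psi varphi phi : ℂ → ℂ} (hpsi0 : ∀ z, psi z ≠ 0)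
    (hconst : m ≠ 0 → ∃ z w, varphi z ≠ varphi w) {A B C D : ℂ}
    (hC : C ≠ 0) (hD : D = b + a * B - b * A) (hAB : ∀ y, varphi y = A * y + B)
    (hphi : ∀ y, C * Complex.exp (D * y) * phi y = psi y * (a * (A * y + B) + b) ^ m)
    {p q : FockSpace × FockSpace} (hp : p ∈ maxWCO m psi varphi phi)
    (hq : q ∈ maxWCO m psi varphi phi) :
    fockInner q.2 (wcConj h p.1) = fockInner q.1 (wcConj h p.2) := by
  have hA : m ≠ 0 → A ≠ 0 := by
    rintro hm rfl
    obtain ⟨z, w, hzw⟩ := hconst hm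
    exact hzw (by rw [hAB, hAB, zero_mul, zero_mul])
  have hrel : ∀ s ∈ maxWCO m psi varphi phi, ∀ y, C * Complex.exp (D * y) * s.1.1 (A * y + B) =
      (a * (A * y + B) + b) ^ m * iteratedDeriv m s.2.1 y := by
    intro s hs y
    have h1 : psi y * s.1.1 (varphi y) = phi y * iteratedDeriv m s.2.1 y := hs y
    rw [hAB] at h1
    refine mul_left_cancel₀ (hpsi0 y) ?_
    linear_combination (C * Complex.exp (D * y)) * h1 + iteratedDeriv m s.2.1 y * hphi y
  rw [fockInner_eq, fockInner_eq]
  exact congrArg _ (h.gaussPair_wcConjFun_eq q.1.2 q.2.2 p.1.2 p.2.2 hC hD hA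
    (hrel q hq) (hrel p hp))

theorem mainTheorem1 (m : ℕ) (a b c : ℂ) (habc : IsConjugationParam a b c)
    (psi varphi phi : ℂ → ℂ)
    (hpsi : Differentiable ℂ psi) (hvarphi : Differentiable ℂ varphi)
    (hphi : Differentiable ℂ phi)
    (hpsi0 : ∀ z, psi z ≠ 0) (hphi0 : ∃ z, phi z ≠ 0)
    (hconst : m ≠ 0 → ∃ z w, varphi z ≠ varphi w)
    (S : MultiOp) (hS : S ≤ maxWCO m psi varphi phi) :
    IsJSelfadjoint (wcConj habc) S ↔
      S = maxWCO m psi varphi phi ∧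
      ∃ A B C D : ℂ, C ≠ 0 ∧ D = b + a * B - b * A ∧
        (∀ y, varphi y = A * y + B) ∧
        (∀ y, C * Complex.exp (D * y) * phi y = psi y * (a * (A * y + B) + b) ^ m) := by
  have ha : a ≠ 0 := by
    rintro rfl
    simpa using habc.norm_a
  constructor
  · intro hself
    have hmem : ∀ p, p ∈ adjointGraph (wcConj habc) S ↔ p ∈ S := fun p => by
      rw [show adjointGraph (wcConj habc) S = (S : Set (FockSpace × FockSpace)) from hself]
      rfl
    have hker : ∀ y, kernelPair habc m psi varphi phi y ∈ maxWCO m psi varphi phi := fun y =>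
      hS ((hmem _).1 fun q hq => (mem_maxWCO_iff_kernelPair habc m psi varphi phi q).1 (hS hq) y)
    have hcond := exists_affine_of_kernel_equation (b := b) ha hpsi hvarphi hphi hpsi0 hphi0 hconst
      fun y => (kernelPair_mem_maxWCO_iff habc m psi varphi phi y).1 (hker y)
    -- Symmetry on the maximal graph places every maximal pair in the adjoint of S, which is S
    -- itself.
    refine ⟨le_antisymm hS fun p hp => (hmem p).1 fun q hq => ?_, hcond⟩
    obtain ⟨A, B, C, D, hC, hD, hAB, hphiC⟩ := hcond
    exact fockInner_wcConj_eq_of_mem_maxWCO habc hpsi0 hconst hC hD hAB hphiC hp (hS hq)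
  · rintro ⟨rfl, A, B, C, D, hC, hD, hAB, hphiC⟩
    refine Set.Subset.antisymm (fun p hp => ?_) fun p hp q hq =>
      fockInner_wcConj_eq_of_mem_maxWCO habc hpsi0 hconst hC hD hAB hphiC hp hq
    refine (mem_maxWCO_iff_kernelPair habc m psi varphi phi p).2 fun y => ?_
    have hker := (kernelPair_mem_maxWCO_iff habc m psi varphi phi y).2
      (kernel_equation_of_affine hD hAB hphiC y)
    have h1 := hp _ hker
    rw [fockInner_wcConj_comm, fockInner_wcConj_comm habc _ p.2] at h1
    exact h1.symm
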